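/- **Setting.** Let $0<\alpha<1$ and $0<T<\infty$. Let $X$ be a real, separable, infinite-dimensional Hilbert space and let $A:D(A)\subset X\to X$ be a densely defined linear operator with a bounded inverse $A^{-1}:X\to X$ that is compact, symmetric and positive. Let $(\phi_n)_{n\in\mathbb N}\subset D(A)$ be an orthonormal basis of $X$ with $A\phi_n=\lambda_n\phi_n$, where $(\lambda_n)$ is positive, non-decreasing and tends to infinity (such a basis exists). For $s\geqslant 0$ put $$D(A^{s})=\Big\{x\in X:\ \|x\|_{D(A^s)}^2:=\sum_{n}\lambda_n^{2s}(x,\phi_n)_X^2<\infty\Big\},$$ and for $x,y\in D(A^{1/2})$ let $(Ax,y)_X:=\sum_n\lambda_n(x,\phi_n)_X(y,\phi_n)_X$. The Riemann–Liouville derivative is $$(\mathrm D_{0+}^\alpha v)(t)=\frac{\mathrm d}{\mathrm dt}\,\frac1{\Gamma(1-\alpha)}\int_0^t(t-s)^{-\alpha}v(s)\,\mathrm ds .$$ For $u_0\in X$, a solution of the fractional diffusion equation is a function $u\in C([0,T];X)$ with $u(0)=u_0$, $u(t)\in D(A)$ for $0<t\leqslant T$, and $$\big(\mathrm D_{0+}^\alpha(u-u_0)\big)(t)+Au(t)=0,\qquad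 0<t\leqslant T$$ (with a one-sided derivative at $t=T$). For $\sigma\geqslant1$ and an integer $J\geqslant1$ let $t_j=(j/J)^\sigma T$, $0\leqslant j\leqslant J$, and let $W_\tau$ be the space of functions on $(0,T)$ with values in $D(A^{1/2})$ that are constant on each $(t_{j-1},t_j)$, $1\leqslant j\leqslant J$. The piecewise-constant discontinuous Galerkin (DG) approximation is $U\in W_\tau$ such that $$\int_0^T\big((\mathrm D_{0+}^\alpha+A)U,V\big)_X\,\mathrm dt=\int_0^T\big(\mathrm D_{0+}^\alpha u_0,V\big)_X\,\mathrm dt\qquad\text{for all }V\in W_\tau .$$ **Theorem 3.1.** Let $0<\alpha<1$, $0<\nu\leqslant1$, $\sigma\geqslant1$ and $0<T<\infty$. There is a constant $C>0$ depending only on $\alpha,\sigma,\nu,T$ such that, for all $X$, $A$ as above and all $u_0\in D(A^\nu)$, the equation has a solution, for every integer $J\geqslant1$ the scheme has a solution $U\in W_\tau$, and every such $u$ and $U$ satisfy $$\|u-U\|_{L^\infty(0,T;X)}\leqslant C\,J^{-\min\{\sigma\nu\alpha,1\}}\,\|u_0\|_{D(A^\nu)} .$$ -/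

import Mathlib

open MeasureTheory Set Filter
open scoped Topology ENNReal

namespace FracDG

/-! ### The operator and its spectral decomposition -/

section Operator

variable {X : Type*} [NormedAddCommGroup X] [InnerProductSpace ℝ X]

/-- `A : D(A) ⊂ X → X` is densely defined and has a bounded inverse `A⁻¹ : X → X` which is
compact, symmetric and positive (`ContinuousLinearMap.IsPositive` is symmetry together with
`0 ≤ (A⁻¹ x, x)`; since `A⁻¹` is injective this gives `0 < (A⁻¹ x, x)` for `x ≠ 0`). -/
structure IsAdmissible (A : X →ₗ.[ℝ] X) : Prop where
  dense_domain : Dense (A.domain : Set X)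
  exists_inverse : ∃ B : X →L[ℝ] X,
    (∀ x : A.domain, B (A x) = x) ∧
    (∀ y : X, ∃ h : B y ∈ A.domain, A ⟨B y, h⟩ = y) ∧
    IsCompactOperator B ∧ B.IsPositive

/-- An orthonormal basis `(φ n)` of `X` made of eigenvectors of `A`, with eigenvalues `lam n`
that form a positive non-decreasing sequence tending to infinity. -/
structure SpectralDecomposition (A : X →ₗ.[ℝ] X) where
  φ : HilbertBasis ℕ ℝ X
  lam : ℕ → ℝ
  mem_domain : ∀ n, φ n ∈ A.domain
  apply_eq : ∀ n, A ⟨φ n, mem_domain n⟩ = lam n • φ n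
  lam_pos : ∀ n, 0 < lam n
  lam_mono : Monotone lam
  lam_tendsto : Tendsto lam atTop atTop

/-- An infinite family of reals with finite sublevel sets can be listed in non-decreasing order. -/
theorem exists_equiv_monotone {ι : Type*} [Infinite ι] (f : ι → ℝ)
    (hf : ∀ c : ℝ, {i | f i ≤ c}.Finite) :
    ∃ e : ℕ ≃ ι, Monotone (f ∘ e) ∧ Tendsto (f ∘ e) atTop atTop := by
  classical
  have hcount : Countable ι := by
    have h : (⋃ n : ℕ, {i | f i ≤ (n : ℝ)}) = (univ : Set ι) := by
      ext i
      simp only [mem_iUnion, mem_univ, iff_true]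
      exact exists_nat_ge (f i)
    rw [← Set.countable_univ_iff, ← h]
    exact Set.countable_iUnion fun n => (hf n).countable
  obtain ⟨g, hg⟩ := exists_injective_nat ι
  let key : ι → ℝ ×ₗ ℕ := fun i => toLex (f i, g i)
  have hkey : Function.Injective key := by
    intro i j h
    have h2 : (f i, g i) = (f j, g j) := toLex.injective h
    exact hg (Prod.mk.inj h2).2
  have hle : ∀ i j, key i ≤ key j → f i ≤ f j := by
    intro i j h
    rcases Prod.Lex.toLex_le_toLex.1 h with h | h
    · exact h.le
    · exact h.1.le
  have hfin : ∀ i, {j | key j < key i}.Finite := fun i =>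
    (hf (f i)).subset fun j hj => hle j i (le_of_lt hj)
  let rk : ι → ℕ := fun i => {j | key j < key i}.ncard
  have hrk : ∀ i j, key i < key j → rk i < rk j := by
    intro i j h
    refine Set.ncard_lt_ncard ⟨fun k hk => lt_trans hk h, fun hsub => ?_⟩ (hfin j)
    exact lt_irrefl (key i) (hsub (show i ∈ {k | key k < key j} from h))
  have hinj : Function.Injective rk := by
    intro i j h
    rcases lt_trichotomy (key i) (key j) with h' | h' | h'
    · exact absurd h (hrk i j h').ne
    · exact hkey h'
    · exact absurd h (hrk j i h').ne'
  have hsurj : Function.Surjective rk := by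
    intro m
    obtain ⟨i, hi⟩ : ∃ i, m < rk i := by
      by_contra! hcon
      have : (range rk).Finite := (Set.finite_Iic m).subset (by
        rintro _ ⟨i, rfl⟩
        exact hcon i)
      exact this.not_infinite (Set.infinite_range_of_injective hinj)
    have himg : rk '' {j | key j < key i} = Set.Iio (rk i) := by
      refine Set.eq_of_subset_of_ncard_le ?_ ?_ (Set.finite_Iio _)
      · rintro _ ⟨j, hj, rfl⟩
        exact hrk j i hj
      · rw [Set.ncard_image_of_injective _ hinj, ← Finset.coe_Iio, Set.ncard_coe_finset,
          Nat.card_Iio]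
    obtain ⟨j, -, hj⟩ : m ∈ rk '' {j | key j < key i} := by
      rw [himg]
      exact hi
    exact ⟨j, hj⟩
  let e : ι ≃ ℕ := Equiv.ofBijective rk ⟨hinj, hsurj⟩
  have hmono : Monotone (f ∘ e.symm) := by
    intro m n hmn
    refine hle _ _ ?_
    by_contra! hlt
    have h := hrk _ _ hlt
    have h1 : rk (e.symm m) = m := e.apply_symm_apply m
    have h2 : rk (e.symm n) = n := e.apply_symm_apply n
    omega
  refine ⟨e.symm, hmono, tendsto_atTop_atTop_of_monotone hmono fun b => ?_⟩
  obtain ⟨i, hi⟩ : ∃ i, b < f i := by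
    by_contra! hcon
    exact Set.infinite_univ ((hf b).subset fun i _ => hcon i)
  exact ⟨e i, by simpa using hi.le⟩

/-- The spectral theorem for `A`: a spectral decomposition exists. -/
theorem nonempty_spectralDecomposition [CompleteSpace X] (hX : ¬ FiniteDimensional ℝ X)
    {A : X →ₗ.[ℝ] X} (hA : IsAdmissible A) : Nonempty (SpectralDecomposition A) := by
  classical
  obtain ⟨B, hBA, hAB, hcomp, hpos⟩ := hA.exists_inverse
  have hinj : ∀ y, B y = 0 → y = 0 := by
    intro y hy
    obtain ⟨h, hA'⟩ := hAB y
    have h0 : (⟨B y, h⟩ : A.domain) = 0 := Subtype.ext hy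
    rw [← hA', h0, LinearPMap.map_zero]
  have hsym : (B : X →ₗ[ℝ] X).IsSymmetric := hpos.1
  let E : ℝ → Submodule ℝ X := fun μ => Module.End.eigenspace (B : X →ₗ[ℝ] X) μ
  have hclosed : ∀ μ, IsClosed (E μ : Set X) := by
    intro μ
    have : (E μ : Set X) = {x | B x = μ • x} := by
      ext x
      exact Module.End.mem_eigenspace_iff
    rw [this]
    exact isClosed_eq B.continuous (continuous_const_smul μ)
  have hcompl : ∀ μ, CompleteSpace (E μ) := fun μ => (hclosed μ).completeSpace_coe
  choose w b hb using fun μ => exists_hilbertBasis ℝ (E μ)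
  have hfam : OrthogonalFamily ℝ (fun μ => E μ) fun μ => (E μ).subtypeₗᵢ :=
    hsym.orthogonalFamily_eigenspaces
  let v : (Σ μ, w μ) → X := fun a => (b a.1 a.2 : X)
  have hv : Orthonormal ℝ v :=
    hfam.orthonormal_sigma_orthonormal fun μ => (b μ).orthonormal
  have hspan : (Submodule.span ℝ (range v))ᗮ = ⊥ := by
    rw [eq_bot_iff]
    intro x hx
    have hx' : x ∈ (⨆ μ, E μ)ᗮ := by
      rw [Submodule.mem_orthogonal] at hx ⊢
      intro y hy
      induction hy using Submodule.iSup_induction' with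
      | mem μ y hy =>
        have h1 : ((InnerProductSpace.toDual ℝ X x).comp (E μ).subtypeL) = 0 := by
          have hd := (b μ).dense_span
          refine ContinuousLinearMap.ext_on
            (s := range (b μ)) ?_ ?_
          · exact Submodule.dense_iff_topologicalClosure_eq_top.2 hd
          · rintro _ ⟨i, rfl⟩
            have := hx (v ⟨μ, i⟩) (Submodule.subset_span ⟨_, rfl⟩)
            simp only [ContinuousLinearMap.comp_apply, InnerProductSpace.toDual_apply_apply,
              zero_apply]
            rw [real_inner_comm]
            exact this
        have h2 := congrArg (fun l => l (⟨y, hy⟩ : E μ)) h1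
        simp only [ContinuousLinearMap.comp_apply, InnerProductSpace.toDual_apply_apply,
          zero_apply] at h2
        rw [real_inner_comm]
        exact h2
      | zero => simp
      | add y z _ _ hy hz => rw [inner_add_left, hy, hz, add_zero]
    have := ContinuousLinearMap.orthogonalComplement_iSup_eigenspaces_eq_bot hcomp hsym
    change x ∈ (⨆ μ, Module.End.eigenspace (B : X →ₗ[ℝ] X) μ)ᗮ at hx'
    rwa [this] at hx'
  have hev : ∀ a : (Σ μ, w μ), B (v a) = a.1 • v a := fun a =>
    Module.End.mem_eigenspace_iff.1 (b a.1 a.2).2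
  have hnorm : ∀ a, ‖v a‖ = 1 := hv.1
  have hinner : ∀ a : (Σ μ, w μ), 0 ≤ a.1 := by
    intro a
    have h := hpos.2 (v a)
    rw [ContinuousLinearMap.reApplyInnerSelf_apply, hev, real_inner_smul_left,
      real_inner_self_eq_norm_sq, hnorm] at h
    simpa using h
  have hmu : ∀ a : (Σ μ, w μ), 0 < a.1 := by
    intro a
    refine lt_of_le_of_ne (hinner a) fun h0 => ?_
    have h1 := hev a
    rw [← h0, zero_smul] at h1
    have h2 := hnorm a
    rw [hinj _ h1, norm_zero] at h2
    exact zero_ne_one h2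
  have hinf : Infinite (Σ μ, w μ) := by
    by_contra hfin
    rw [not_infinite_iff_finite] at hfin
    have hfd : FiniteDimensional ℝ (Submodule.span ℝ (range v)) :=
      FiniteDimensional.span_of_finite ℝ (Set.finite_range v)
    have htop : Submodule.span ℝ (range v) = ⊤ :=
      Submodule.orthogonal_eq_bot_iff.1 hspan
    rw [htop] at hfd
    exact hX (Module.Finite.equiv (Submodule.topEquiv (R := ℝ) (M := X)))
  have hsub : ∀ c : ℝ, {a : (Σ μ, w μ) | a.1⁻¹ ≤ c}.Finite := by
    intro c
    by_contra hnf
    have hS : {a : (Σ μ, w μ) | a.1⁻¹ ≤ c}.Infinite := hnf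
    have hc : 0 < c := by
      obtain ⟨a, ha⟩ := hS.nonempty
      exact lt_of_lt_of_le (inv_pos.2 (hmu a)) ha
    let s : ℕ → (Σ μ, w μ) := fun n => (hS.natEmbedding _ n : (Σ μ, w μ))
    have hs : ∀ n, c⁻¹ ≤ (s n).1 := fun n =>
      inv_le_of_inv_le₀ (hmu _) (hS.natEmbedding _ n).2
    have hsinj : Function.Injective s :=
      Subtype.val_injective.comp (hS.natEmbedding _).injective
    obtain ⟨K, hK, hKs⟩ := hcomp.image_closedBall_subset_compact (𝕜₁ := ℝ) 1
    have hmem : ∀ n, B (v (s n)) ∈ K := fun n =>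
      hKs ⟨v (s n), by simp [hnorm], rfl⟩
    obtain ⟨y, -, k, hk, hlim⟩ := hK.tendsto_subseq hmem
    have hcau := hlim.cauchySeq
    rw [Metric.cauchySeq_iff] at hcau
    obtain ⟨N, hN⟩ := hcau c⁻¹ (inv_pos.2 hc)
    have h1 := hN N le_rfl (N + 1) (Nat.le_succ N)
    have hne : s (k N) ≠ s (k (N + 1)) := fun h =>
      (hk (Nat.lt_succ_self N)).ne (hsinj h)
    have horth : inner ℝ (v (s (k N))) (v (s (k (N + 1)))) = 0 := hv.2 hne
    have h2 : ‖(s (k N)).1 • v (s (k N)) - (s (k (N + 1))).1 • v (s (k (N + 1)))‖ ^ 2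
        = (s (k N)).1 ^ 2 + (s (k (N + 1))).1 ^ 2 := by
      rw [norm_sub_sq_real, norm_smul, norm_smul, hnorm, hnorm, real_inner_smul_left,
        real_inner_smul_right, horth]
      simp
    simp only [Function.comp_apply, hev, dist_eq_norm] at h1
    have h3 := pow_lt_pow_left₀ h1 (norm_nonneg _) two_ne_zero
    rw [h2] at h3
    have h4 := pow_le_pow_left₀ (inv_pos.2 hc).le (hs (k N)) 2
    nlinarith [sq_nonneg (s (k (N + 1))).1]
  obtain ⟨e, hmono, htend⟩ := exists_equiv_monotone (fun a : (Σ μ, w μ) => a.1⁻¹) hsub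
  let Φ : HilbertBasis ℕ ℝ X :=
    HilbertBasis.mkOfOrthogonalEqBot (hv.comp e e.injective) (by
      rw [e.surjective.range_comp]
      exact hspan)
  have hΦ : ∀ n, Φ n = v (e n) := fun n => by
    have := HilbertBasis.coe_mkOfOrthogonalEqBot (hv.comp e e.injective) (by
      rw [e.surjective.range_comp]
      exact hspan)
    exact congrFun this n
  have hBΦ : ∀ n, B ((e n).1⁻¹ • Φ n) = Φ n := by
    intro n
    rw [map_smul, hΦ, hev, smul_smul, inv_mul_cancel₀ (hmu _).ne', one_smul]
  have hdom : ∀ n, Φ n ∈ A.domain := fun n => by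
    obtain ⟨h, -⟩ := hAB ((e n).1⁻¹ • Φ n)
    rwa [hBΦ] at h
  refine ⟨⟨Φ, fun n => (e n).1⁻¹, hdom, fun n => ?_, fun n => inv_pos.2 (hmu _), hmono, htend⟩⟩
  obtain ⟨h, h'⟩ := hAB ((e n).1⁻¹ • Φ n)
  rw [← h']
  congr 1
  exact Subtype.ext (hBΦ n).symm

/-- The fixed spectral decomposition of `A`. -/
noncomputable def spectralDecomposition [CompleteSpace X] (hX : ¬ FiniteDimensional ℝ X)
    {A : X →ₗ.[ℝ] X} (hA : IsAdmissible A) : SpectralDecomposition A :=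
  Classical.choice (nonempty_spectralDecomposition hX hA)

variable {A : X →ₗ.[ℝ] X}

/-- The domain `D(A^s)` of a fractional power, `s ≥ 0`: all `x = ∑ cₙ φₙ` in `X` with
`∑ λₙ^(2s) cₙ² < ∞`. -/
def SpectralDecomposition.domPow (S : SpectralDecomposition A) (s : ℝ) : Set X :=
  {x | Summable fun n => S.lam n ^ (2 * s) * (inner ℝ x (S.φ n)) ^ 2}

/-- The norm of `D(A^s)`. -/
noncomputable def SpectralDecomposition.normPow (S : SpectralDecomposition A) (s : ℝ) (x : X) :
    ℝ :=
  Real.sqrt (∑' n, S.lam n ^ (2 * s) * (inner ℝ x (S.φ n)) ^ 2)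

/-- The pairing `(A x, y)_X` of `A x ∈ D(A^(-1/2))` with `y ∈ D(A^(1/2))`, for
`x, y ∈ D(A^(1/2))`. -/
noncomputable def SpectralDecomposition.energy (S : SpectralDecomposition A) (x y : X) : ℝ :=
  ∑' n, S.lam n * inner ℝ x (S.φ n) * inner ℝ y (S.φ n)

end Operator

/-! ### Fractional calculus -/

section Fractional

variable {X : Type*} [NormedAddCommGroup X] [NormedSpace ℝ X]

/-- The Riemann–Liouville integral `D_{0+}^(-β) v` of order `β > 0`. -/
noncomputable def fracInt (β : ℝ) (v : ℝ → X) (t : ℝ) : X :=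
  (Real.Gamma β)⁻¹ • ∫ s in (0 : ℝ)..t, (t - s) ^ (β - 1) • v s

/-- The Riemann–Liouville derivative `D_{0+}^α v = D D_{0+}^(α-1) v` of order `0 < α < 1`. It is
applied below to piecewise constant functions only; for these `D_{0+}^(α-1) v` is absolutely
continuous and continuously differentiable off the break points, so that its distributional
derivative is the integrable function given by the classical derivative. -/
noncomputable def fracDeriv (α : ℝ) (v : ℝ → X) (t : ℝ) : X :=
  deriv (fracInt (1 - α) v) t

end Fractional

section Problem

variable {X : Type*} [NormedAddCommGroup X] [InnerProductSpace ℝ X]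

/-- `u ∈ C([0,T]; X)` is the solution of `D_{0+}^α (u - u₀) (t) + A u (t) = 0` for `0 < t ≤ T`
with `u(0) = u₀`: for all such `t` the value `u t` lies in `D(A)` and the fractional integral of
order `1 - α` of `u - u₀` has derivative `- A u(t)` at `t` (from the left at `t = T`). -/
structure IsSolution (A : X →ₗ.[ℝ] X) (α T : ℝ) (u₀ : X) (u : ℝ → X) : Prop where
  continuousOn : ContinuousOn u (Icc 0 T)
  initial : u 0 = u₀
  equation : ∀ t ∈ Ioc 0 T, ∃ h : u t ∈ A.domain,
    HasDerivWithinAt (fracInt (1 - α) fun s => u s - u₀) (-(A ⟨u t, h⟩)) (Icc 0 T) t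

/-! ### The discretization -/

/-- The graded grid `t_j = (j/J)^σ T`. -/
noncomputable def grid (σ T : ℝ) (J j : ℕ) : ℝ := ((j : ℝ) / (J : ℝ)) ^ σ * T

variable {A : X →ₗ.[ℝ] X}

/-- The space `W_τ` of functions with values in `D(A^(1/2))` that are constant on each grid
interval `(t_{j-1}, t_j)`, `1 ≤ j ≤ J`. -/
def SpectralDecomposition.W (S : SpectralDecomposition A) (σ T : ℝ) (J : ℕ) : Set (ℝ → X) :=
  {v | ∀ j : ℕ, 1 ≤ j → j ≤ J → ∃ c ∈ S.domPow (1 / 2),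
    ∀ t ∈ Ioo (grid σ T J (j - 1)) (grid σ T J j), v t = c}

/-- `U ∈ W_τ` is a discontinuous Galerkin approximation:
`∫₀ᵀ ((D_{0+}^α + A) U, V)_X dt = ∫₀ᵀ (D_{0+}^α u₀, V)_X dt` for all `V ∈ W_τ`. -/
structure SpectralDecomposition.IsDG (S : SpectralDecomposition A) (α σ T : ℝ) (J : ℕ) (u₀ : X)
    (U : ℝ → X) : Prop where
  mem : U ∈ S.W σ T J
  equation : ∀ V ∈ S.W σ T J,
    ∫ t in (0 : ℝ)..T, (inner ℝ (fracDeriv α U t) (V t) + S.energy (U t) (V t)) =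
      ∫ t in (0 : ℝ)..T, inner ℝ (fracDeriv α (fun _ => u₀) t) (V t)

end Problem

end FracDG

namespace FracDG

/-! ### Lower triangular systems -/

section Triangular

/-! In the eigenbasis both problems decouple into scalar ones. With `μ = Γ(1-α) λₙ`, each
coefficient of a solution satisfies the time-integrated equation `RelaxEq`, and the coefficients of
the cell values of `U` satisfy the lower triangular system with matrix `dgMatrix`. Everything rests
on a scalar error bound that is uniform in `μ ≥ 0`; squaring and summing over the modes then gives
the estimate in `X`.

Stability: the kernel `x ^ (-α) + μ` is positive, decreasing and log-convex (`kernel_log_convex`).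
Hence the ratios of consecutive rows of the matrix decrease along the row, and Kaluza's argument
(`triangular_inverse_nonpos`) makes the off-diagonal entries of the inverse nonpositive. Its row
sums are nonnegative by comparison, so the maximum norm of each row is controlled by the diagonal
(`dgMatrix_stability`), and the diagonal is bounded below independently of `μ`.

Consistency: cell averages of the exact solution are inserted into the scheme. The `μ` part cancels
exactly and the remaining kernel integrals of mean-zero functions telescope, so the error is at most
five times the largest oscillation of the solution on a cell (`dg_scalar_error`).

Oscillation: the scalar solution with initial value one is nonincreasing, between zero and one, and
satisfies a secant inequality expressing convexity (`relaxation_shape`). These facts hold for the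
scheme on uniform meshes and pass to the limit by the same error bound, which also yields
uniqueness. Combined with `1 - e x ≤ 2 (μ x ^ α) ^ ν` and the relative step size `O(1/m)` of the
graded grid, they give an oscillation of order `λ ^ ν J ^ (-min (σνα) 1)` (`relaxation_osc_le`).

Existence: the Mittag-Leffler series solves the scalar equation. Its bound by one and its decay `λ
e(t) ≤ C t ^ (-α)` make the assembled series a continuous curve with values in the domain of `A` for
`t > 0`. The discrete solution is assembled from scalar ones in the same way. -/

theorem exists_triangular_solution (a : ℕ → ℕ → ℝ) (ha : ∀ m, a m m ≠ 0) (F : ℕ → ℝ) :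
    ∃ V : ℕ → ℝ, ∀ m, ∑ j ∈ Finset.range (m + 1), a m j * V j = F m := by
  let V : ℕ → ℝ := fun n => Nat.strongRecOn n fun m ih =>
    (F m - ∑ j : Fin m, a m j * ih j j.2) / a m m
  have hV : ∀ m, V m = (F m - ∑ j : Fin m, a m j * V j) / a m m := fun m => by
    simp only [V]
    rw [Nat.strongRecOn_eq]
  refine ⟨V, fun m => ?_⟩
  rw [Finset.sum_range_succ, hV m, Finset.sum_range fun j => a m j * V j,
    mul_div_cancel₀ _ (ha m)]
  ring

theorem triangular_unique {a : ℕ → ℕ → ℝ} (ha : ∀ m, a m m ≠ 0) {V : ℕ → ℝ} {M : ℕ}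
    (hV : ∀ m ≤ M, ∑ j ∈ Finset.range (m + 1), a m j * V j = 0) : ∀ m ≤ M, V m = 0 := by
  intro m
  induction m using Nat.strong_induction_on with
  | _ m ih =>
    intro hm
    have h := hV m hm
    rw [Finset.sum_range_succ, Finset.sum_eq_zero, zero_add] at h
    · exact (mul_eq_zero.1 h).resolve_left (ha m)
    · intro j hj
      have hj' := Finset.mem_range.1 hj
      rw [ih j hj' (hj'.le.trans hm), mul_zero]

/-- A discrete comparison principle. -/
theorem triangular_nonneg {a : ℕ → ℕ → ℝ} (ha : ∀ m, 0 < a m m)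
    (hdec : ∀ m, ∀ j ≤ m, a (m + 1) j ≤ a m j) {F V : ℕ → ℝ} {M : ℕ}
    (hF0 : 0 ≤ F 0) (hF : ∀ m < M, F m ≤ F (m + 1))
    (hV : ∀ m ≤ M, ∑ j ∈ Finset.range (m + 1), a m j * V j = F m) : ∀ m ≤ M, 0 ≤ V m := by
  intro m
  induction m using Nat.strong_induction_on with
  | _ m ih =>
    intro hm
    refine nonneg_of_mul_nonneg_right (a := a m m) ?_ (ha m)
    have h := hV m hm
    rw [Finset.sum_range_succ] at h
    cases m with
    | zero => simp at h; linarith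
    | succ m =>
      have h1 := hV m (by omega)
      have h2 := hF m (by omega)
      -- The entries decrease down each column and the earlier values are nonnegative, so the
      -- diagonal term is at least the increment of the data.
      have h3 : ∑ j ∈ Finset.range (m + 1), a (m + 1) j * V j ≤
          ∑ j ∈ Finset.range (m + 1), a m j * V j := by
        refine Finset.sum_le_sum fun j hj => ?_
        have hj' := Finset.mem_range.1 hj
        exact mul_le_mul_of_nonneg_right (hdec m j (by omega)) (ih j hj' (by omega))
      linarith

/-- Kaluza's sign property: if the ratios of consecutive rows decrease along the row, the
off-diagonal entries of the inverse matrix are nonpositive. -/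
theorem triangular_inverse_nonpos {a : ℕ → ℕ → ℝ} (ha : ∀ m, ∀ j ≤ m, 0 < a m j)
    (hratio : ∀ m j, ∀ i ≤ j, j ≤ m → a (m + 1) j * a m i ≤ a (m + 1) i * a m j)
    {P : ℕ → ℝ} {k : ℕ}
    (hP : ∀ m, ∑ j ∈ Finset.range (m + 1), a m j * P j = if m = k then 1 else 0) :
    (∀ m < k, P m = 0) ∧ P k = 1 / a k k ∧ ∀ m, k < m → P m ≤ 0 := by
  have hdiag : ∀ m, a m m ≠ 0 := fun m => (ha m m le_rfl).ne'
  have h0 : ∀ m < k, P m = 0 := by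
    intro m hm
    refine triangular_unique (M := m) hdiag (fun i hi => ?_) m le_rfl
    rw [hP, if_neg (by omega)]
  have hk : P k = 1 / a k k := by
    have h := hP k
    rw [if_pos rfl, Finset.sum_range_succ, Finset.sum_eq_zero, zero_add] at h
    · rw [eq_div_iff (hdiag k), mul_comm, h]
    · intro j hj
      rw [h0 j (Finset.mem_range.1 hj), mul_zero]
  refine ⟨h0, hk, fun m => ?_⟩
  induction m using Nat.strong_induction_on with
  | _ m ih =>
    intro hm
    obtain ⟨n, rfl⟩ : ∃ n, m = n + 1 := ⟨m - 1, by omega⟩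
    have h := hP (n + 1)
    rw [if_neg (by omega), Finset.sum_range_succ] at h
    -- Rows `n` and `n + 1` are compared after cross-multiplying by their entries in column `k`. The
    -- terms at `j = k` agree; for `j > k` the ratio inequality is reversed by the nonpositive `P
    -- j`.
    have hsum : 0 ≤ a n k * ∑ j ∈ Finset.range (n + 1), a (n + 1) j * P j := by
      have h1 : 0 ≤ a (n + 1) k * ∑ j ∈ Finset.range (n + 1), a n j * P j := by
        rw [hP]
        split_ifs
        · simpa using (ha (n + 1) k (by omega)).le
        · simp
      refine h1.trans ?_
      rw [Finset.mul_sum, Finset.mul_sum]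
      refine Finset.sum_le_sum fun j hj => ?_
      have hj' := Finset.mem_range.1 hj
      rcases lt_trichotomy j k with hjk | rfl | hjk
      · rw [h0 j hjk]; simp
      · exact le_of_eq (by ring)
      · have h2 := ih j hj' hjk
        have h3 := hratio n j k hjk.le (by omega)
        nlinarith
    have h4 := nonneg_of_mul_nonneg_right hsum (ha n k (by omega))
    by_contra! hcon
    have := mul_pos (ha (n + 1) (n + 1) le_rfl) hcon
    linarith

/-- Stability of lower triangular systems with Kaluza's property. -/
theorem triangular_stability {a : ℕ → ℕ → ℝ} (ha : ∀ m, ∀ j ≤ m, 0 < a m j)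
    (hdec : ∀ m, ∀ j ≤ m, a (m + 1) j ≤ a m j)
    (hratio : ∀ m j, ∀ i ≤ j, j ≤ m → a (m + 1) j * a m i ≤ a (m + 1) i * a m j)
    {F V : ℕ → ℝ} {M : ℕ} {K : ℝ}
    (hV : ∀ m ≤ M, ∑ j ∈ Finset.range (m + 1), a m j * V j = F m)
    (hF : ∀ m ≤ M, |F m| ≤ K) : |V M| ≤ 2 * K / a M M := by
  have hdiag : ∀ m, a m m ≠ 0 := fun m => (ha m m le_rfl).ne'
  -- `P k` is the `k`-th column of the inverse matrix.
  choose P hP using fun k => exists_triangular_solution a hdiag (fun m => if m = k then 1 else 0)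
  have hPs := fun k => triangular_inverse_nonpos ha hratio (hP k)
  have key : ∀ G : ℕ → ℝ, ∀ m ≤ M, ∑ j ∈ Finset.range (m + 1), a m j *
      (∑ k ∈ Finset.range (M + 1), P k j * G k) = G m := by
    intro G m hm
    simp only [Finset.mul_sum]
    rw [Finset.sum_comm]
    have : ∀ k ∈ Finset.range (M + 1), ∑ j ∈ Finset.range (m + 1), a m j * (P k j * G k) =
        if m = k then G k else 0 := by
      intro k _
      simp only [← mul_assoc]
      rw [← Finset.sum_mul, hP]
      split_ifs <;> simp
    rw [Finset.sum_congr rfl this, Finset.sum_ite_eq, if_pos (Finset.mem_range.2 (by omega))]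
  have hrep : V M = ∑ k ∈ Finset.range (M + 1), P k M * F k := by
    have := triangular_unique (M := M) hdiag
      (V := fun j => V j - ∑ k ∈ Finset.range (M + 1), P k j * F k) (fun m hm => by
        simp only [mul_sub, Finset.sum_sub_distrib]
        rw [hV m hm, key F m hm, sub_self]) M le_rfl
    linarith
  -- The row sum of the inverse is the solution with constant data, which the comparison principle
  -- makes nonnegative. The off-diagonal absolute values therefore sum to at most `1 / a M M`,
  -- whence the factor two.
  have hone : 0 ≤ ∑ k ∈ Finset.range (M + 1), P k M * (1 : ℝ) :=
    triangular_nonneg (F := fun _ => 1) (M := M) (fun m => ha m m le_rfl) hdec zero_le_one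
      (fun _ _ => le_rfl) (key fun _ => 1) M le_rfl
  have hK : 0 ≤ K := (abs_nonneg _).trans (hF 0 (Nat.zero_le _))
  simp only [mul_one] at hone
  rw [Finset.sum_range_succ, (hPs M).2.1] at hone
  rw [hrep, Finset.sum_range_succ, (hPs M).2.1]
  have h1 : |∑ k ∈ Finset.range M, P k M * F k| ≤ -(∑ k ∈ Finset.range M, P k M) * K := by
    refine (Finset.abs_sum_le_sum_abs _ _).trans ?_
    rw [← Finset.sum_neg_distrib, Finset.sum_mul]
    refine Finset.sum_le_sum fun k hk => ?_
    have hk' := Finset.mem_range.1 hk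
    have h2 := (hPs k).2.2 M hk'
    rw [abs_mul, abs_of_nonpos h2]
    exact mul_le_mul_of_nonneg_left (hF k hk'.le) (neg_nonneg.2 h2)
  have h3 : |1 / a M M * F M| ≤ 1 / a M M * K := by
    rw [abs_mul, abs_of_pos (one_div_pos.2 (ha M M le_rfl))]
    exact mul_le_mul_of_nonneg_left (hF M le_rfl) (one_div_pos.2 (ha M M le_rfl)).le
  have h4 : -(∑ k ∈ Finset.range M, P k M) * K ≤ 1 / a M M * K :=
    mul_le_mul_of_nonneg_right (by linarith) hK
  calc _ ≤ _ := abs_add_le _ _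
    _ ≤ 1 / a M M * K + 1 / a M M * K := by linarith
    _ = 2 * K / a M M := by ring

end Triangular

/-! ### The matrix of the scheme -/

section Kernel

/-- The primitive of `x ↦ x ^ (-α)` that vanishes at `0`. -/
noncomputable def prim (α x : ℝ) : ℝ := x ^ (1 - α) / (1 - α)

/-- The matrix of the piecewise constant scheme for the kernel `x ^ (-α) + μ` on the mesh `t`. -/
noncomputable def dgMatrix (α μ : ℝ) (t : ℕ → ℝ) (m j : ℕ) : ℝ :=
  prim α (t (m + 1) - t j) - prim α (t (m + 1) - t (j + 1)) + μ * (t (j + 1) - t j)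

variable {α μ : ℝ}

theorem prim_zero (hα' : α < 1) : prim α 0 = 0 := by
  rw [prim, Real.zero_rpow (by linarith), zero_div]

theorem continuous_prim (hα' : α < 1) : Continuous (prim α) :=
  (Real.continuous_rpow_const (by linarith)).div_const _

theorem hasDerivAt_prim (hα' : α < 1) {x : ℝ} (hx : 0 < x) :
    HasDerivAt (prim α) (x ^ (-α)) x := by
  have h := (Real.hasDerivAt_rpow_const (x := x) (p := 1 - α) (Or.inl hx.ne')).div_const (1 - α)
  have h1 : (1 - α) ≠ 0 := by linarith
  have h2 : (1 - α) * x ^ (1 - α - 1) / (1 - α) = x ^ (-α) := by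
    rw [mul_div_cancel_left₀ _ h1]
    congr 1
    ring
  rw [h2] at h
  exact h

theorem prim_pos (hα' : α < 1) {x : ℝ} (hx : 0 < x) : 0 < prim α x :=
  div_pos (Real.rpow_pos_of_pos hx _) (by linarith)

theorem prim_nonneg (hα' : α < 1) {x : ℝ} (hx : 0 ≤ x) : 0 ≤ prim α x :=
  div_nonneg (Real.rpow_nonneg hx _) (by linarith)

theorem prim_le_prim (hα' : α < 1) {x y : ℝ} (hx : 0 ≤ x) (hxy : x ≤ y) :
    prim α x ≤ prim α y :=
  div_le_div_of_nonneg_right (Real.rpow_le_rpow hx hxy (by linarith)) (by linarith)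

theorem rpow_neg_le_rpow_neg (hα : 0 < α) {x y : ℝ} (hx : 0 < x) (hxy : x ≤ y) :
    y ^ (-α) ≤ x ^ (-α) :=
  Real.rpow_le_rpow_of_nonpos hx hxy (by linarith)

/-- The increments of the decreasing convex function `x ^ (-α)`. -/
theorem rpow_neg_increment_le (hα : 0 < α) {x y δ : ℝ} (hx : 0 < x) (hxy : x ≤ y) (hδ : 0 ≤ δ) :
    y ^ (-α) - (y + δ) ^ (-α) ≤ x ^ (-α) - (x + δ) ^ (-α) := by
  -- Both factors on the right are nonnegative and nonincreasing in `z`.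
  have key : ∀ z, 0 < z → z ^ (-α) - (z + δ) ^ (-α) = z ^ (-α) * (1 - (z / (z + δ)) ^ α) := by
    intro z hz
    have h1 : 0 < z ^ α := Real.rpow_pos_of_pos hz _
    have h2 : 0 < (z + δ) ^ α := Real.rpow_pos_of_pos (by linarith) _
    rw [Real.div_rpow hz.le (by linarith), Real.rpow_neg hz.le, Real.rpow_neg (by linarith)]
    field_simp
  have hy : 0 < y := hx.trans_le hxy
  rw [key x hx, key y hy]
  have h1 : x / (x + δ) ≤ y / (y + δ) := by
    rw [div_le_div_iff₀ (by linarith) (by linarith)]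
    nlinarith
  have h2 : (x / (x + δ)) ^ α ≤ (y / (y + δ)) ^ α :=
    Real.rpow_le_rpow (by positivity) h1 hα.le
  have h3 : (y / (y + δ)) ^ α ≤ 1 :=
    Real.rpow_le_one (by positivity) ((div_le_one (by linarith)).2 (by linarith)) hα.le
  exact mul_le_mul (rpow_neg_le_rpow_neg hα hx hxy) (by linarith) (by linarith)
    (Real.rpow_nonneg hx.le _)

/-- Expanding in `μ`: the quadratic terms cancel, the linear ones are compared by convexity of the
power, and the constant ones by `(y + δ) x ≤ (x + δ) y`. Thus adding a constant keeps the power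
kernel log-convex. -/
theorem kernel_log_convex (hα : 0 < α) (hμ : 0 ≤ μ) {x y δ : ℝ} (hx : 0 < x) (hxy : x ≤ y)
    (hδ : 0 ≤ δ) :
    ((x + δ) ^ (-α) + μ) * (y ^ (-α) + μ) ≤ ((y + δ) ^ (-α) + μ) * (x ^ (-α) + μ) := by
  have hy : 0 < y := hx.trans_le hxy
  have h1 : (x + δ) ^ (-α) * y ^ (-α) ≤ (y + δ) ^ (-α) * x ^ (-α) := by
    rw [← Real.mul_rpow (by linarith) hy.le, ← Real.mul_rpow (by linarith) hx.le]
    exact rpow_neg_le_rpow_neg hα (by positivity) (by nlinarith)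
  nlinarith [mul_le_mul_of_nonneg_left (rpow_neg_increment_le hα hx hxy hδ) hμ]

theorem hasDerivAt_dg_primitive (hα' : α < 1) (μ : ℝ) {T s : ℝ} (hs : s < T) :
    HasDerivAt (fun s => -prim α (T - s) + μ * s) ((T - s) ^ (-α) + μ) s := by
  have h1 : HasDerivAt (fun s => T - s) (-1) s := by
    simpa using (hasDerivAt_id s).const_sub T
  have h2 := ((hasDerivAt_prim hα' (sub_pos.2 hs)).comp s h1).neg.add
    ((hasDerivAt_id s).const_mul μ)
  exact h2.congr_deriv (by ring)

variable {t : ℕ → ℝ}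

/-- Within a row every entry is an increment of one and the same primitive; row sums telescope and
Cauchy's mean value theorem applies. -/
theorem dgMatrix_eq_sub (m j : ℕ) : dgMatrix α μ t m j =
    (-prim α (t (m + 1) - t (j + 1)) + μ * t (j + 1)) -
      (-prim α (t (m + 1) - t j) + μ * t j) := by
  rw [dgMatrix]
  ring

theorem dgMatrix_pos (hα' : α < 1) (hμ : 0 ≤ μ) (ht : StrictMono t) (m j : ℕ) (hj : j ≤ m) :
    0 < dgMatrix α μ t m j := by
  have h1 : t j < t (j + 1) := ht (Nat.lt_succ_self _)
  have h2 : t (j + 1) ≤ t (m + 1) := ht.monotone (by omega)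
  have h3 : prim α (t (m + 1) - t (j + 1)) < prim α (t (m + 1) - t j) :=
    div_lt_div_of_pos_right
      (Real.rpow_lt_rpow (by linarith) (by linarith) (by linarith)) (by linarith)
  have h4 : 0 ≤ μ * (t (j + 1) - t j) := mul_nonneg hμ (by linarith)
  rw [dgMatrix]
  linarith

/-- Discarding the `μ` part of the diagonal is what makes the stability bound independent of `μ`. -/
theorem dgMatrix_diag_ge (hα' : α < 1) (hμ : 0 ≤ μ) (ht : StrictMono t) (m : ℕ) :
    prim α (t (m + 1) - t m) ≤ dgMatrix α μ t m m := by
  have h1 : t m < t (m + 1) := ht (Nat.lt_succ_self _)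
  rw [dgMatrix, sub_self, prim_zero hα', sub_zero]
  linarith [mul_nonneg hμ (sub_nonneg.2 h1.le)]

theorem continuous_dg_primitive (hα' : α < 1) (μ T : ℝ) :
    Continuous (fun s => -prim α (T - s) + μ * s) :=
  ((continuous_prim hα').comp (by fun_prop)).neg.add (by fun_prop)

/-- Consecutive rows of the matrix are related by a mean value of the ratio of the kernels. -/
theorem dgMatrix_exists_ratio (hα' : α < 1) (ht : StrictMono t) (m j : ℕ) (hj : j ≤ m) :
    ∃ ξ ∈ Ioo (t j) (t (j + 1)),
      dgMatrix α μ t m j * ((t (m + 2) - ξ) ^ (-α) + μ) =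
        dgMatrix α μ t (m + 1) j * ((t (m + 1) - ξ) ^ (-α) + μ) := by
  have h1 : t j < t (j + 1) := ht (Nat.lt_succ_self _)
  have h2 : t (j + 1) ≤ t (m + 1) := ht.monotone (by omega)
  have h3 : t (m + 1) < t (m + 2) := ht (by omega)
  -- Cauchy's mean value theorem needs only continuity at the endpoints, so the kernel singularity
  -- at `t (m + 1)` is harmless when `j = m`.
  obtain ⟨ξ, hξ, h⟩ := exists_ratio_hasDerivAt_eq_ratio_slope
    (fun s => -prim α (t (m + 2) - s) + μ * s) (fun s => (t (m + 2) - s) ^ (-α) + μ) h1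
    (continuous_dg_primitive hα' μ _).continuousOn
    (fun x hx => hasDerivAt_dg_primitive hα' μ (by linarith [hx.2]))
    (fun s => -prim α (t (m + 1) - s) + μ * s) (fun s => (t (m + 1) - s) ^ (-α) + μ)
    (continuous_dg_primitive hα' μ _).continuousOn
    (fun x hx => hasDerivAt_dg_primitive hα' μ (by linarith [hx.2]))
  refine ⟨ξ, hξ, ?_⟩
  rw [dgMatrix_eq_sub, dgMatrix_eq_sub]
  exact h

theorem dgMatrix_decreasing (hα : 0 < α) (hα' : α < 1) (hμ : 0 ≤ μ) (ht : StrictMono t)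
    (m j : ℕ) (hj : j ≤ m) : dgMatrix α μ t (m + 1) j ≤ dgMatrix α μ t m j := by
  obtain ⟨ξ, hξ, h⟩ := dgMatrix_exists_ratio (μ := μ) hα' ht m j hj
  have h2 : t (j + 1) ≤ t (m + 1) := ht.monotone (by omega)
  have h3 : t (m + 1) < t (m + 2) := ht (by omega)
  have hy : 0 < t (m + 1) - ξ := by linarith [hξ.2]
  have h4 := rpow_neg_le_rpow_neg hα hy (show t (m + 1) - ξ ≤ t (m + 2) - ξ by linarith)
  have h5 : 0 < (t (m + 1) - ξ) ^ (-α) + μ := add_pos_of_pos_of_nonneg (Real.rpow_pos_of_pos hy _) hμ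
  have h6 := dgMatrix_pos (μ := μ) hα' hμ ht m j hj
  refine le_of_mul_le_mul_right ?_ h5
  rw [← h]
  exact mul_le_mul_of_nonneg_left (by linarith) h6.le

/-- The ratio of the two rows in a column equals `k (x + δ) / k x` for the kernel `k` at some `x = t
(m + 1) - ξ`, with `ξ` in the corresponding cell. Later cells have smaller `x`, and log-convexity
makes this quotient increase with `x`. -/
theorem dgMatrix_ratio (hα : 0 < α) (hα' : α < 1) (hμ : 0 ≤ μ) (ht : StrictMono t)
    (m j i : ℕ) (hij : i ≤ j) (hj : j ≤ m) :
    dgMatrix α μ t (m + 1) j * dgMatrix α μ t m i ≤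
      dgMatrix α μ t (m + 1) i * dgMatrix α μ t m j := by
  rcases hij.eq_or_lt with rfl | hlt
  · rfl
  obtain ⟨ξ, hξ, h⟩ := dgMatrix_exists_ratio (μ := μ) hα' ht m j hj
  obtain ⟨η, hη, h'⟩ := dgMatrix_exists_ratio (μ := μ) hα' ht m i (by omega)
  have h1 : t (i + 1) ≤ t j := ht.monotone (by omega)
  have h2 : t (j + 1) ≤ t (m + 1) := ht.monotone (by omega)
  have h3 : t (m + 1) < t (m + 2) := ht (by omega)
  have hx : 0 < t (m + 1) - ξ := by linarith [hξ.2]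
  have hy : 0 < t (m + 1) - η := by linarith [hη.2, hξ.1, hξ.2]
  have hlog := kernel_log_convex hα hμ hx
    (show t (m + 1) - ξ ≤ t (m + 1) - η by linarith [hη.2, hξ.1]) (sub_nonneg.2 h3.le)
  rw [show t (m + 1) - ξ + (t (m + 2) - t (m + 1)) = t (m + 2) - ξ by ring,
    show t (m + 1) - η + (t (m + 2) - t (m + 1)) = t (m + 2) - η by ring] at hlog
  have k1 : 0 < (t (m + 1) - ξ) ^ (-α) + μ := add_pos_of_pos_of_nonneg (Real.rpow_pos_of_pos hx _) hμ
  have k2 : 0 < (t (m + 1) - η) ^ (-α) + μ := add_pos_of_pos_of_nonneg (Real.rpow_pos_of_pos hy _) hμ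
  have p1 := dgMatrix_pos (μ := μ) hα' hμ ht m j hj
  have p2 := dgMatrix_pos (μ := μ) hα' hμ ht m i (by omega)
  refine le_of_mul_le_mul_right ?_ (mul_pos k1 k2)
  calc _ = (dgMatrix α μ t (m + 1) j * ((t (m + 1) - ξ) ^ (-α) + μ)) * dgMatrix α μ t m i *
        ((t (m + 1) - η) ^ (-α) + μ) := by ring
    _ = (dgMatrix α μ t m j * dgMatrix α μ t m i) *
        (((t (m + 2) - ξ) ^ (-α) + μ) * ((t (m + 1) - η) ^ (-α) + μ)) := by rw [← h]; ring
    _ ≤ (dgMatrix α μ t m j * dgMatrix α μ t m i) *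
        (((t (m + 2) - η) ^ (-α) + μ) * ((t (m + 1) - ξ) ^ (-α) + μ)) :=
      mul_le_mul_of_nonneg_left hlog (mul_pos p1 p2).le
    _ = (dgMatrix α μ t (m + 1) i * ((t (m + 1) - η) ^ (-α) + μ)) * dgMatrix α μ t m j *
        ((t (m + 1) - ξ) ^ (-α) + μ) := by rw [← h']; ring
    _ = _ := by ring

/-- Stability of the scheme, uniformly in `μ ≥ 0` and in the mesh. -/
theorem dgMatrix_stability (hα : 0 < α) (hα' : α < 1) (hμ : 0 ≤ μ) (ht : StrictMono t)
    {F V : ℕ → ℝ} {M : ℕ} {K : ℝ}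
    (hV : ∀ m ≤ M, ∑ j ∈ Finset.range (m + 1), dgMatrix α μ t m j * V j = F m)
    (hF : ∀ m ≤ M, |F m| ≤ K) : |V M| ≤ 2 * K / prim α (t (M + 1) - t M) := by
  refine (triangular_stability (dgMatrix_pos hα' hμ ht) (dgMatrix_decreasing hα hα' hμ ht)
    (dgMatrix_ratio hα hα' hμ ht) hV hF).trans ?_
  have hK : 0 ≤ K := (abs_nonneg _).trans (hF 0 (Nat.zero_le _))
  exact div_le_div_of_nonneg_left (by linarith)
    (prim_pos hα' (sub_pos.2 (ht (Nat.lt_succ_self _)))) (dgMatrix_diag_ge hα' hμ ht M)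

end Kernel

/-! ### The error estimate for scalar problems -/

section Error

variable {α μ : ℝ}

theorem intervalIntegrable_kernel (hα' : α < 1) (T a b : ℝ) :
    IntervalIntegrable (fun s => (T - s) ^ (-α)) volume a b := by
  have h := (intervalIntegral.intervalIntegrable_rpow' (a := T - a) (b := T - b)
    (r := -α) (by linarith)).comp_sub_left T
  simpa using h

theorem integral_kernel (hα' : α < 1) (T a b : ℝ) :
    ∫ s in a..b, (T - s) ^ (-α) = prim α (T - a) - prim α (T - b) := by
  rw [intervalIntegral.integral_comp_sub_left (fun x => x ^ (-α)) T,
    integral_rpow (Or.inl (by linarith)), prim, prim, show -α + 1 = 1 - α by ring]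
  ring

theorem intervalIntegrable_kernel_mul (hα' : α < 1) (T : ℝ) {a b : ℝ} {v : ℝ → ℝ}
    (hv : ContinuousOn v (uIcc a b)) :
    IntervalIntegrable (fun s => (T - s) ^ (-α) * v s) volume a b :=
  (intervalIntegrable_kernel hα' T a b).mul_continuousOn hv

theorem abs_integral_kernel_mul_le (hα' : α < 1) {T a b ε : ℝ} (hab : a ≤ b) (hbT : b ≤ T)
    {w : ℝ → ℝ} (hw : ∀ s ∈ Icc a b, |w s| ≤ ε) :
    |∫ s in a..b, (T - s) ^ (-α) * w s| ≤ ε * (prim α (T - a) - prim α (T - b)) := by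
  rw [← integral_kernel hα', ← intervalIntegral.integral_const_mul, ← Real.norm_eq_abs]
  refine intervalIntegral.norm_integral_le_of_norm_le hab ?_
    ((intervalIntegrable_kernel hα' T a b).const_mul ε)
  refine ae_of_all _ fun s hs => ?_
  have h : 0 ≤ (T - s) ^ (-α) := Real.rpow_nonneg (by linarith [hs.2]) _
  rw [norm_mul, Real.norm_of_nonneg h, mul_comm]
  exact mul_le_mul_of_nonneg_right (hw s ⟨hs.1.le, hs.2⟩) h

/-- A mean-zero factor allows the constant `(T - a) ^ (-α)` to be subtracted from the kernel. What
remains is bounded by the kernel increment over the cell, which telescopes when cells are added. -/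
theorem abs_integral_kernel_mul_le_of_mean_zero (hα : 0 < α) (hα' : α < 1) {T a b ε : ℝ}
    (hab : a ≤ b) (hbT : b < T) {w : ℝ → ℝ} (hw : ∀ s ∈ Icc a b, |w s| ≤ ε)
    (hwc : ContinuousOn w (Icc a b)) (hw0 : ∫ s in a..b, w s = 0) :
    |∫ s in a..b, (T - s) ^ (-α) * w s| ≤
      ε * (b - a) * ((T - b) ^ (-α) - (T - a) ^ (-α)) := by
  have hwc' : ContinuousOn w (uIcc a b) := by rwa [uIcc_of_le hab]
  have h1 : ∫ s in a..b, (T - s) ^ (-α) * w s =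
      ∫ s in a..b, ((T - s) ^ (-α) - (T - a) ^ (-α)) * w s := by
    have h2 : ∫ s in a..b, (T - a) ^ (-α) * w s = 0 := by
      rw [intervalIntegral.integral_const_mul, hw0, mul_zero]
    rw [← sub_zero (∫ s in a..b, (T - s) ^ (-α) * w s), ← h2,
      ← intervalIntegral.integral_sub (intervalIntegrable_kernel_mul hα' T hwc')
        (hwc'.intervalIntegrable.const_mul _)]
    simp only [sub_mul]
  rw [h1, ← Real.norm_eq_abs]
  refine (intervalIntegral.norm_integral_le_of_norm_le_const
    (C := ((T - b) ^ (-α) - (T - a) ^ (-α)) * ε) fun s hs => ?_).trans (le_of_eq ?_)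
  · rw [uIoc_of_le hab] at hs
    have h3 := rpow_neg_le_rpow_neg hα (show 0 < T - s by linarith [hs.2])
      (show T - s ≤ T - a by linarith [hs.1])
    have h4 := rpow_neg_le_rpow_neg hα (show 0 < T - b by linarith [hs.2])
      (show T - b ≤ T - s by linarith [hs.2])
    rw [norm_mul, Real.norm_of_nonneg (by linarith), Real.norm_eq_abs]
    exact mul_le_mul (by linarith) (hw s ⟨hs.1.le, hs.2⟩) (abs_nonneg _) (by linarith)
  · rw [abs_of_nonneg (by linarith)]
    ring

/-- The scalar equation `∫₀ˣ (x - s)^(-α) v(s) ds + μ ∫₀ˣ v = c x^(1-α) / (1-α)`, which is the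
time-integrated fractional relaxation equation with initial value `c`. -/
def RelaxEq (α μ c : ℝ) (v : ℝ → ℝ) (x : ℝ) : Prop :=
  (∫ s in (0 : ℝ)..x, (x - s) ^ (-α) * v s) + μ * ∫ s in (0 : ℝ)..x, v s = c * prim α x

variable {t : ℕ → ℝ}

/-- The integral over `(0, t_n)` as a sum over mesh cells. -/
theorem integral_eq_sum_cells (ht0 : t 0 = 0) (ht : StrictMono t) {n : ℕ} {f : ℝ → ℝ}
    (hf : IntervalIntegrable f volume 0 (t n)) :
    ∫ s in (0 : ℝ)..t n, f s = ∑ j ∈ Finset.range n, ∫ s in t j..t (j + 1), f s := by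
  rw [intervalIntegral.sum_integral_adjacent_intervals, ht0]
  intro k hk
  refine hf.mono_set ?_
  have h0 : 0 ≤ t k := ht0 ▸ ht.monotone (Nat.zero_le k)
  have h1 : t k ≤ t (k + 1) := ht.monotone (Nat.le_succ k)
  have h2 : t (k + 1) ≤ t n := ht.monotone hk
  rw [uIcc_of_le h1, uIcc_of_le (by linarith)]
  exact Icc_subset_Icc h0 h2

/-- The piecewise constant scheme is accurate up to a multiple of the oscillation of the solution
on the cells, uniformly in `μ ≥ 0` and in the mesh. -/
theorem dg_scalar_error (hα : 0 < α) (hα' : α < 1) (hμ : 0 ≤ μ) (ht0 : t 0 = 0)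
    (ht : StrictMono t) (hstep : Monotone fun j => t (j + 1) - t j) {c ε : ℝ} {M : ℕ}
    {v : ℝ → ℝ} {V : ℕ → ℝ} (hvc : ContinuousOn v (Icc 0 (t (M + 1))))
    (hv : ∀ m ≤ M, RelaxEq α μ c v (t (m + 1)))
    (hV : ∀ m ≤ M, ∑ j ∈ Finset.range (m + 1), dgMatrix α μ t m j * V j = c * prim α (t (m + 1)))
    (hosc : ∀ j ≤ M, ∀ s ∈ Icc (t j) (t (j + 1)), ∀ r ∈ Icc (t j) (t (j + 1)), |v s - v r| ≤ ε)
    {s : ℝ} (hs : s ∈ Icc (t M) (t (M + 1))) : |V M - v s| ≤ 5 * ε := by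
  have hlt : ∀ j, t j < t (j + 1) := fun j => ht (Nat.lt_succ_self j)
  have hnn : ∀ j, 0 ≤ t j := fun j => ht0 ▸ ht.monotone (Nat.zero_le j)
  have hcell : ∀ j ≤ M, ContinuousOn v (Icc (t j) (t (j + 1))) := fun j hj =>
    hvc.mono (Icc_subset_Icc (hnn j) (ht.monotone (by omega)))
  have hint : ∀ j ≤ M, IntervalIntegrable v volume (t j) (t (j + 1)) := fun j hj =>
    ContinuousOn.intervalIntegrable (by rw [uIcc_of_le (hlt j).le]; exact hcell j hj)
  -- The scheme is compared with cell averages rather than point values because averages reproduce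
  -- `∫ v` exactly, so no `μ` survives in the defect.
  let avg : ℕ → ℝ := fun j => (∫ r in t j..t (j + 1), v r) / (t (j + 1) - t j)
  have havg0 : ∀ j, (t (j + 1) - t j) * avg j = ∫ r in t j..t (j + 1), v r := fun j =>
    mul_div_cancel₀ _ (sub_pos.2 (hlt j)).ne'
  have hmean : ∀ j ≤ M, ∫ r in t j..t (j + 1), (v r - avg j) = 0 := by
    intro j hj
    rw [intervalIntegral.integral_sub (hint j hj) intervalIntegrable_const,
      intervalIntegral.integral_const, smul_eq_mul, havg0, sub_self]
  have havg : ∀ j ≤ M, ∀ r ∈ Icc (t j) (t (j + 1)), |v r - avg j| ≤ ε := by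
    intro j hj r hr
    have h1 : (t (j + 1) - t j) * (v r - avg j) = ∫ q in t j..t (j + 1), (v r - v q) := by
      rw [intervalIntegral.integral_sub intervalIntegrable_const (hint j hj),
        intervalIntegral.integral_const, smul_eq_mul, ← havg0]
      ring
    have h2 : |∫ q in t j..t (j + 1), (v r - v q)| ≤ ε * |t (j + 1) - t j| := by
      rw [← Real.norm_eq_abs]
      refine intervalIntegral.norm_integral_le_of_norm_le_const fun q hq => ?_
      rw [uIoc_of_le (hlt j).le] at hq
      exact hosc j hj r hr q ⟨hq.1.le, hq.2⟩
    rw [← h1, abs_mul, mul_comm ε] at h2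
    exact le_of_mul_le_mul_left h2 (abs_pos.2 (sub_pos.2 (hlt j)).ne')
  have hε : 0 ≤ ε := (abs_nonneg _).trans (havg M le_rfl s hs)
  have hsys : ∀ m ≤ M, ∑ j ∈ Finset.range (m + 1), dgMatrix α μ t m j * (V j - avg j) =
      ∑ j ∈ Finset.range (m + 1),
        ∫ r in t j..t (j + 1), (t (m + 1) - r) ^ (-α) * (v r - avg j) := by
    intro m hm
    simp only [mul_sub, Finset.sum_sub_distrib]
    have hvm : ContinuousOn v (uIcc 0 (t (m + 1))) := by
      rw [uIcc_of_le (hnn _)]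
      exact hvc.mono (Icc_subset_Icc le_rfl (ht.monotone (by omega)))
    rw [hV m hm, ← hv m hm,
      integral_eq_sum_cells ht0 ht (intervalIntegrable_kernel_mul hα' _ hvm),
      integral_eq_sum_cells ht0 ht hvm.intervalIntegrable, Finset.mul_sum,
      ← Finset.sum_add_distrib, ← Finset.sum_sub_distrib]
    refine Finset.sum_congr rfl fun j hj => ?_
    have hj' := Finset.mem_range.1 hj
    rw [intervalIntegral.integral_sub (intervalIntegrable_kernel_mul hα' _
        (by rw [uIcc_of_le (hlt j).le]; exact hcell j (by omega)))
      ((intervalIntegrable_kernel hα' _ _ _).mul_const _),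
      intervalIntegral.integral_mul_const, integral_kernel hα', dgMatrix, add_mul, mul_assoc,
      havg0]
    ring
  have hFbound : ∀ m ≤ M, |∑ j ∈ Finset.range (m + 1),
      ∫ r in t j..t (j + 1), (t (m + 1) - r) ^ (-α) * (v r - avg j)| ≤
        2 * ε * prim α (t (M + 1) - t M) := by
    intro m hm
    have hτ : 0 < t (m + 1) - t m := sub_pos.2 (hlt m)
    have h1 : |∫ r in t m..t (m + 1), (t (m + 1) - r) ^ (-α) * (v r - avg m)| ≤
        ε * prim α (t (m + 1) - t m) := by
      have := abs_integral_kernel_mul_le hα' (hlt m).le le_rfl (havg m hm)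
      rwa [sub_self, prim_zero hα', sub_zero] at this
    -- On the cells before the last one the mean-zero bound applies; replacing their lengths by the
    -- longest, `t (m + 1) - t m`, lets the kernel increments telescope.
    have h2 : |∑ j ∈ Finset.range m,
        ∫ r in t j..t (j + 1), (t (m + 1) - r) ^ (-α) * (v r - avg j)| ≤
          ε * prim α (t (m + 1) - t m) := by
      calc _ ≤ ∑ j ∈ Finset.range m,
            |∫ r in t j..t (j + 1), (t (m + 1) - r) ^ (-α) * (v r - avg j)| :=
          Finset.abs_sum_le_sum_abs _ _
        _ ≤ ∑ j ∈ Finset.range m, ε * (t (m + 1) - t m) *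
            ((t (m + 1) - t (j + 1)) ^ (-α) - (t (m + 1) - t j) ^ (-α)) := by
          refine Finset.sum_le_sum fun j hj => ?_
          have hj' := Finset.mem_range.1 hj
          have hlt' : t (j + 1) < t (m + 1) := ht (by omega)
          refine (abs_integral_kernel_mul_le_of_mean_zero hα hα' (hlt j).le hlt'
            (havg j (by omega)) ((hcell j (by omega)).sub continuousOn_const)
            (hmean j (by omega))).trans ?_
          refine mul_le_mul_of_nonneg_right
            (mul_le_mul_of_nonneg_left (hstep (by omega)) hε) (sub_nonneg.2 ?_)
          exact rpow_neg_le_rpow_neg hα (sub_pos.2 hlt') (by linarith [hlt j])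
        _ = ε * (t (m + 1) - t m) *
            ((t (m + 1) - t m) ^ (-α) - (t (m + 1) - t 0) ^ (-α)) := by
          rw [← Finset.mul_sum, Finset.sum_range_sub fun j => (t (m + 1) - t j) ^ (-α)]
        _ ≤ ε * (t (m + 1) - t m) * (t (m + 1) - t m) ^ (-α) := by
          refine mul_le_mul_of_nonneg_left ?_ (mul_nonneg hε hτ.le)
          have : 0 ≤ (t (m + 1) - t 0) ^ (-α) :=
            Real.rpow_nonneg (sub_nonneg.2 (ht.monotone (Nat.zero_le _))) _
          linarith
        _ = ε * (t (m + 1) - t m) ^ (1 - α) := by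
          rw [mul_assoc, sub_eq_add_neg 1 α, Real.rpow_add hτ, Real.rpow_one]
        _ ≤ ε * prim α (t (m + 1) - t m) := by
          refine mul_le_mul_of_nonneg_left ?_ hε
          rw [prim, le_div_iff₀ (by linarith)]
          have := Real.rpow_nonneg hτ.le (1 - α)
          nlinarith
    -- Since the steps grow, the defects of all rows are measured by the final step, exactly the
    -- denominator in the stability bound.
    have h3 : prim α (t (m + 1) - t m) ≤ prim α (t (M + 1) - t M) :=
      prim_le_prim hα' hτ.le (hstep hm)
    rw [Finset.sum_range_succ]
    refine (abs_add_le _ _).trans ?_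
    nlinarith [mul_le_mul_of_nonneg_left h3 hε]
  have h := dgMatrix_stability hα hα' hμ ht hsys hFbound
  have hp := prim_pos hα' (sub_pos.2 (hlt M))
  rw [show 2 * (2 * ε * prim α (t (M + 1) - t M)) / prim α (t (M + 1) - t M) = 4 * ε by
    field_simp; ring] at h
  have h' := havg M le_rfl s hs
  rw [abs_sub_comm] at h'
  calc |V M - v s| = |(V M - avg M) + (avg M - v s)| := by congr 1; ring
    _ ≤ _ := abs_add_le _ _
    _ ≤ 5 * ε := by linarith

end Error

/-! ### Uniform meshes and the shape of the scalar solution -/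

section Uniform

variable {α μ : ℝ}

theorem strictMono_uniform {τ : ℝ} (hτ : 0 < τ) : StrictMono fun j : ℕ => (j : ℝ) * τ :=
  fun _ _ h => mul_lt_mul_of_pos_right (Nat.cast_lt.2 h) hτ

/-- The Toeplitz property: on a uniform mesh, shifting a sequence shifts its image under the matrix.
-/
theorem dgMatrix_uniform_shift (τ : ℝ) (m j : ℕ) :
    dgMatrix α μ (fun j => (j : ℝ) * τ) (m + 1) (j + 1) =
      dgMatrix α μ (fun j => (j : ℝ) * τ) m j := by
  simp only [dgMatrix]
  push_cast
  rw [show ((m : ℝ) + 1 + 1) * τ - (j + 1) * τ = (m + 1) * τ - j * τ by ring,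
    show ((m : ℝ) + 1 + 1) * τ - (j + 1 + 1) * τ = (m + 1) * τ - (j + 1) * τ by ring]
  ring

theorem sum_dgMatrix (hα' : α < 1) {t : ℕ → ℝ} (ht0 : t 0 = 0) (m : ℕ) :
    ∑ j ∈ Finset.range (m + 1), dgMatrix α μ t m j = prim α (t (m + 1)) + μ * t (m + 1) := by
  simp only [dgMatrix_eq_sub]
  rw [Finset.sum_range_sub fun j => -prim α (t (m + 1) - t j) + μ * t j, ht0, sub_self,
    prim_zero hα']
  simp
  ring

/-- On a uniform mesh the discrete solution is nonnegative, nonincreasing and convex. -/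
theorem exists_uniform_solution (hα : 0 < α) (hα' : α < 1) (hμ : 0 ≤ μ) {τ : ℝ} (hτ : 0 < τ) :
    ∃ V : ℕ → ℝ, (∀ m, ∑ j ∈ Finset.range (m + 1), dgMatrix α μ (fun j => (j : ℝ) * τ) m j * V j =
        1 * prim α (((m + 1 : ℕ) : ℝ) * τ)) ∧
      (∀ m, 0 ≤ V m) ∧ (∀ m, V m ≤ 1) ∧ Antitone V ∧
      ∀ p q : ℕ, p ≤ q → ((p : ℝ) + 1) * (V p - V q) ≤ ((q : ℝ) - p) * (1 - V p) := by
  set t : ℕ → ℝ := fun j => (j : ℝ) * τ with ht_def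
  have ht : StrictMono t := strictMono_uniform hτ
  have ht0 : t 0 = 0 := by simp [ht_def]
  have hpos := dgMatrix_pos (μ := μ) hα' hμ ht
  have hdec := dgMatrix_decreasing hα hα' hμ ht
  have hdiag : ∀ m, dgMatrix α μ t m m ≠ 0 := fun m => (hpos m m le_rfl).ne'
  -- By the Toeplitz structure the differences of `S` form the first column of the inverse, so
  -- Kaluza's sign property makes `S` nonincreasing.
  obtain ⟨S, hS⟩ := exists_triangular_solution (dgMatrix α μ t) hdiag fun _ => 1
  have hS0 : ∀ m, 0 ≤ S m := fun m =>
    triangular_nonneg (F := fun _ => 1) (M := m) (fun m => hpos m m le_rfl) hdec zero_le_one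
      (fun _ _ => le_rfl) (fun i _ => hS i) m le_rfl
  have hdiff : ∀ m, ∑ j ∈ Finset.range (m + 1), dgMatrix α μ t m j *
      (if j = 0 then S 0 else S j - S (j - 1)) = if m = 0 then 1 else 0 := by
    intro m
    cases m with
    | zero => simpa using hS 0
    | succ m =>
      have h1 := hS (m + 1)
      rw [Finset.sum_range_succ'] at h1 ⊢
      simp only [Nat.add_eq_zero_iff, one_ne_zero, and_false, if_false, Nat.add_sub_cancel,
        if_true, mul_sub, Finset.sum_sub_distrib]
      have h2 : ∑ j ∈ Finset.range (m + 1), dgMatrix α μ t (m + 1) (j + 1) * S j = 1 := by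
        rw [← hS m]
        exact Finset.sum_congr rfl fun j _ => by rw [dgMatrix_uniform_shift]
      linarith
  have hSanti : Antitone S := antitone_nat_of_succ_le fun m => by
    have := (triangular_inverse_nonpos hpos (dgMatrix_ratio hα hα' hμ ht) hdiff).2.2 (m + 1)
      (Nat.succ_pos m)
    simp at this
    linarith
  have hQ : ∀ m, ∑ j ∈ Finset.range (m + 1), dgMatrix α μ t m j *
      (∑ i ∈ Finset.range (j + 1), S i) = (m : ℝ) + 1 := by
    intro m
    induction m with
    | zero => simpa using hS 0
    | succ m ih =>
      have h1 := hS (m + 1)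
      rw [Finset.sum_range_succ'] at h1 ⊢
      simp only [Finset.sum_range_succ _ (_ + 1), mul_add, Finset.sum_add_distrib]
      have h2 : ∑ j ∈ Finset.range (m + 1), dgMatrix α μ t (m + 1) (j + 1) *
          (∑ i ∈ Finset.range (j + 1), S i) = (m : ℝ) + 1 := by
        rw [← ih]
        exact Finset.sum_congr rfl fun j _ => by rw [dgMatrix_uniform_shift]
      simp only [mul_add, Finset.sum_add_distrib, Finset.sum_range_succ] at h2 h1 ⊢
      push_cast
      simp at h1 h2 ⊢
      linarith
  have hc : 0 ≤ μ * τ := mul_nonneg hμ hτ.le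
  -- The constant one overshoots the data by `μ τ (m + 1)`, and the partial sums of `S` solve the
  -- system with data `m + 1`. The decrements of `V` are thus multiples of the nonincreasing `S`,
  -- which is convexity.
  let V : ℕ → ℝ := fun m => 1 - μ * τ * ∑ i ∈ Finset.range (m + 1), S i
  have hsys : ∀ m, ∑ j ∈ Finset.range (m + 1), dgMatrix α μ t m j * V j =
      1 * prim α (((m + 1 : ℕ) : ℝ) * τ) := by
    intro m
    have h1 : ∀ j, dgMatrix α μ t m j * V j = dgMatrix α μ t m j -
        μ * τ * (dgMatrix α μ t m j * ∑ i ∈ Finset.range (j + 1), S i) := fun j => by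
      simp only [V]
      ring
    simp only [h1, Finset.sum_sub_distrib]
    rw [sum_dgMatrix hα' ht0, ← Finset.mul_sum, hQ]
    simp only [ht_def]
    push_cast
    ring
  have hVdiff : ∀ p q, p ≤ q → V p - V q = μ * τ * ∑ i ∈ Finset.Ico (p + 1) (q + 1), S i := by
    intro p q hpq
    rw [Finset.sum_Ico_eq_sub _ (by omega)]
    simp only [V]
    ring
  refine ⟨V, hsys, fun m => ?_, fun m => ?_, fun p q hpq => ?_, fun p q hpq => ?_⟩
  · refine triangular_nonneg (F := fun m => 1 * prim α (((m + 1 : ℕ) : ℝ) * τ)) (M := m)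
      (fun m => hpos m m le_rfl) hdec ?_ (fun i _ => ?_) (fun i _ => hsys i) m le_rfl
    · rw [one_mul]
      exact prim_nonneg hα' (by positivity)
    · rw [one_mul, one_mul]
      exact prim_le_prim hα' (by positivity) (ht.monotone (by omega))
  · have := mul_nonneg hc (Finset.sum_nonneg fun i (_ : i ∈ Finset.range (m + 1)) => hS0 i)
    simp only [V]
    linarith
  · have := mul_nonneg hc (Finset.sum_nonneg fun i (_ : i ∈ Finset.Ico (p + 1) (q + 1)) => hS0 i)
    linarith [hVdiff p q hpq]
  · rw [hVdiff p q hpq]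
    -- The value `S p` separates the average of `S` after `p` from its average up to `p`.
    have h1 : ∑ i ∈ Finset.Ico (p + 1) (q + 1), S i ≤ ((q : ℝ) - p) * S p := by
      refine (Finset.sum_le_card_nsmul _ _ (S p) fun i hi => hSanti ?_).trans (le_of_eq ?_)
      · have := (Finset.mem_Ico.1 hi).1
        omega
      · rw [Nat.card_Ico, nsmul_eq_mul, show q + 1 - (p + 1) = q - p by omega, Nat.cast_sub hpq]
    have h2 : ((p : ℝ) + 1) * S p ≤ ∑ i ∈ Finset.range (p + 1), S i := by
      refine le_trans (le_of_eq ?_) (Finset.card_nsmul_le_sum _ _ (S p) fun i hi => hSanti ?_)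
      · rw [Finset.card_range, nsmul_eq_mul]
        push_cast
        rfl
      · have := Finset.mem_range.1 hi
        omega
    have h3 : (0 : ℝ) ≤ (q : ℝ) - p := sub_nonneg.2 (Nat.cast_le.2 hpq)
    have h4 : (0 : ℝ) ≤ (p : ℝ) + 1 := by positivity
    have h5 : 1 - V p = μ * τ * ∑ i ∈ Finset.range (p + 1), S i := by simp only [V]; ring
    rw [h5]
    calc ((p : ℝ) + 1) * (μ * τ * ∑ i ∈ Finset.Ico (p + 1) (q + 1), S i)
        ≤ ((p : ℝ) + 1) * (μ * τ * (((q : ℝ) - p) * S p)) := by gcongr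
      _ = ((q : ℝ) - p) * (μ * τ * (((p : ℝ) + 1) * S p)) := by ring
      _ ≤ _ := by gcongr

/-- Convergence of the scheme on uniform meshes. -/
theorem exists_uniform_mesh (hα : 0 < α) (hα' : α < 1) (hμ : 0 ≤ μ) {B c : ℝ} (hB : 0 < B)
    {v : ℝ → ℝ} (hvc : ContinuousOn v (Icc 0 B)) (hv : ∀ x ∈ Icc 0 B, RelaxEq α μ c v x)
    {ε : ℝ} (hε : 0 < ε) : ∃ τ : ℝ, 0 < τ ∧ τ ≤ ε ∧ ∀ V : ℕ → ℝ,
      (∀ m, ∑ j ∈ Finset.range (m + 1), dgMatrix α μ (fun j => (j : ℝ) * τ) m j * V j =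
        c * prim α (((m + 1 : ℕ) : ℝ) * τ)) →
      ∀ x, 0 ≤ x → x < B → |V ⌊x / τ⌋₊ - v x| ≤ ε := by
  have huc := isCompact_Icc.uniformContinuousOn_of_continuous hvc
  rw [Metric.uniformContinuousOn_iff] at huc
  -- The fraction `ε / 5` absorbs the factor in `dg_scalar_error`.
  obtain ⟨δ, hδ, hosc⟩ := huc (ε / 5) (by positivity)
  obtain ⟨N, hN⟩ := exists_nat_gt (B / min δ ε)
  have hm : 0 < min δ ε := lt_min hδ hε
  have hN0 : (0 : ℝ) < N := lt_of_le_of_lt (by positivity) hN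
  have hτ : 0 < B / N := by positivity
  have hτm : B / N < min δ ε := by
    rw [div_lt_iff₀ hN0]
    rwa [div_lt_iff₀ hm, mul_comm] at hN
  refine ⟨B / N, hτ, (hτm.trans_le (min_le_right _ _)).le, fun V hV x hx hxB => ?_⟩
  have hfl : ⌊x / (B / N)⌋₊ < N := by
    rw [Nat.floor_lt (by positivity), div_lt_iff₀ hτ, mul_div_cancel₀ _ hN0.ne']
    exact hxB
  set M := ⌊x / (B / N)⌋₊
  have ht := strictMono_uniform hτ
  have hNB : (N : ℝ) * (B / N) = B := mul_div_cancel₀ _ hN0.ne'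
  have hle : ∀ j ≤ M, ((j + 1 : ℕ) : ℝ) * (B / N) ≤ B := fun j hj => by
    exact (ht.monotone (show j + 1 ≤ N by omega)).trans_eq hNB
  have h := dg_scalar_error (t := fun j : ℕ => (j : ℝ) * (B / N)) (M := M) (c := c) (ε := ε / 5)
    (v := v) (V := V) (s := x) hα hα' hμ (by simp) ht
    (fun i j _ => le_of_eq (by push_cast; ring)) (hvc.mono (Icc_subset_Icc le_rfl (hle M le_rfl)))
    (fun m hm' => hv _ ⟨by positivity, hle m hm'⟩) (fun m _ => hV m)
    (fun j hj s hs r hr => ?_) ?_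
  · linarith
  · have h0 : 0 ≤ (j : ℝ) * (B / N) := by positivity
    have h1 := hle j hj
    have h2 : ((j + 1 : ℕ) : ℝ) * (B / N) = j * (B / N) + B / N := by push_cast; ring
    simp only [h2] at hs hr h1
    have := hosc s ⟨h0.trans hs.1, hs.2.trans h1⟩ r ⟨h0.trans hr.1, hr.2.trans h1⟩ (by
      rw [Real.dist_eq, abs_lt]
      have := hτm.trans_le (min_le_left δ ε)
      constructor <;> linarith [hs.1, hs.2, hr.1, hr.2])
    rw [Real.dist_eq] at this
    exact this.le
  · constructor
    · rw [← le_div_iff₀ hτ]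
      exact Nat.floor_le (by positivity)
    · rw [← div_le_iff₀ hτ]
      push_cast
      exact (Nat.lt_floor_add_one _).le

/-- Uniqueness for the scalar equation. -/
theorem RelaxEq.eq_zero (hα : 0 < α) (hα' : α < 1) (hμ : 0 ≤ μ) {B : ℝ} {v : ℝ → ℝ}
    (hvc : ContinuousOn v (Icc 0 B)) (hv : ∀ x ∈ Icc 0 B, RelaxEq α μ 0 v x) :
    ∀ x ∈ Ico 0 B, v x = 0 := by
  intro x hx
  rw [← abs_eq_zero]
  refine le_antisymm (le_of_forall_pos_le_add fun ε hε => ?_) (abs_nonneg _)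
  obtain ⟨τ, -, -, h⟩ := exists_uniform_mesh hα hα' hμ (hx.1.trans_lt hx.2) hvc hv hε
  -- For zero initial value the zero vector solves every discrete system, and the discrete solutions
  -- approximate `v`.
  have := h (fun _ => 0) (fun m => by simp) x hx.1 hx.2
  simpa using this

/-! ### Shape, decay and initial behaviour of the relaxation function -/

variable {e : ℝ → ℝ}

/-- All four properties are inherited from the discrete solutions on uniform meshes. The last is the
secant form of convexity: the mean descent on `[a, b]` is at most that on `[0, a]`, where the
function starts from one. -/
theorem relaxation_shape (hα : 0 < α) (hα' : α < 1) (hμ : 0 ≤ μ)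
    (hec : ContinuousOn e (Ici 0)) (he : ∀ x, 0 ≤ x → RelaxEq α μ 1 e x) {a b : ℝ} (ha : 0 ≤ a)
    (hab : a ≤ b) :
    0 ≤ e b ∧ e b ≤ e a ∧ e a ≤ 1 ∧ a * (e a - e b) ≤ (b - a) * (1 - e a) := by
  have key : ∀ ε > 0, -ε ≤ e b ∧ e b ≤ e a + 2 * ε ∧ e a ≤ 1 + ε ∧
      a * (e a - e b) ≤ (b - a + ε) * (1 - e a + ε) + 2 * a * ε := by
    intro ε hε
    -- The interval is enlarged because the approximation holds only strictly before its right end.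
    obtain ⟨τ, hτ, hτε, h⟩ := exists_uniform_mesh (B := b + 1) hα hα' hμ (by linarith)
      (hec.mono Icc_subset_Ici_self) (fun x hx => he x hx.1) hε
    obtain ⟨V, hV, hV0, hV1, hanti, hconv⟩ := exists_uniform_solution hα hα' hμ hτ
    have h1 := abs_le.1 (h V hV a ha (by linarith))
    have h2 := abs_le.1 (h V hV b (by linarith) (by linarith))
    have hpq : ⌊a / τ⌋₊ ≤ ⌊b / τ⌋₊ := Nat.floor_mono (by gcongr)
    have hp1 : (⌊a / τ⌋₊ : ℝ) * τ ≤ a := by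
      rw [← le_div_iff₀ hτ]; exact Nat.floor_le (by positivity)
    have hq1 : (⌊b / τ⌋₊ : ℝ) * τ ≤ b := by
      rw [← le_div_iff₀ hτ]; exact Nat.floor_le (div_nonneg (by linarith) hτ.le)
    have hp2 : a ≤ (⌊a / τ⌋₊ + 1 : ℝ) * τ := by
      rw [← div_le_iff₀ hτ]; exact (Nat.lt_floor_add_one _).le
    have h3 := hconv _ _ hpq
    have h4 := hanti hpq
    have h5 := hV1 ⌊a / τ⌋₊
    have h6 := hV0 ⌊b / τ⌋₊
    set p := ⌊a / τ⌋₊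
    set q := ⌊b / τ⌋₊
    refine ⟨by linarith, by linarith, by linarith, ?_⟩
    have h7 : a * (V p - V q) ≤ (b - a + ε) * (1 - V p) := by
      calc a * (V p - V q) ≤ ((p + 1 : ℝ) * τ) * (V p - V q) :=
            mul_le_mul_of_nonneg_right hp2 (by linarith)
        _ = τ * ((p + 1 : ℝ) * (V p - V q)) := by ring
        _ ≤ τ * (((q : ℝ) - p) * (1 - V p)) := mul_le_mul_of_nonneg_left h3 hτ.le
        _ = (q * τ - p * τ) * (1 - V p) := by ring
        _ ≤ _ := mul_le_mul_of_nonneg_right (by linarith) (by linarith)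
    have h8 : a * (e a - e b) ≤ a * (V p - V q + 2 * ε) :=
      mul_le_mul_of_nonneg_left (by linarith) ha
    have h9 : (b - a + ε) * (1 - V p) ≤ (b - a + ε) * (1 - e a + ε) :=
      mul_le_mul_of_nonneg_left (by linarith) (by linarith)
    nlinarith
  have lim : ∀ {x : ℝ} {g : ℝ → ℝ}, Continuous g → (∀ ε > 0, x ≤ g ε) → x ≤ g 0 :=
    fun {x g} hg hx => ge_of_tendsto (hg.continuousWithinAt (s := Ioi 0) (x := 0))
      (eventually_nhdsWithin_of_forall fun ε hε => hx ε hε)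
  refine ⟨?_, ?_, ?_, ?_⟩
  · have := lim (x := 0) (g := fun ε => e b + ε) (by fun_prop)
      fun ε hε => by linarith [(key ε hε).1]
    simpa using this
  · have := lim (g := fun ε => e a + 2 * ε) (by fun_prop) fun ε hε => (key ε hε).2.1
    simpa using this
  · have := lim (g := fun ε => 1 + ε) (by fun_prop) fun ε hε => (key ε hε).2.2.1
    simpa using this
  · have := lim (g := fun ε => (b - a + ε) * (1 - e a + ε) + 2 * a * ε) (by fun_prop)
      fun ε hε => (key ε hε).2.2.2
    simpa using this

/-- In the integrated equation the memory term is nonnegative and may be dropped, while monotonicity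
gives `x * e x ≤ ∫ e`. -/
theorem relaxation_decay (hα : 0 < α) (hα' : α < 1) (hμ : 0 ≤ μ)
    (hec : ContinuousOn e (Ici 0)) (he : ∀ x, 0 ≤ x → RelaxEq α μ 1 e x) {x : ℝ} (hx : 0 < x) :
    μ * e x ≤ x ^ (-α) / (1 - α) := by
  have hshape := fun {a b : ℝ} (ha : 0 ≤ a) (hab : a ≤ b) => relaxation_shape hα hα' hμ hec he ha hab
  have h := he x hx.le
  have hint : IntervalIntegrable e volume 0 x := ContinuousOn.intervalIntegrable
    (by rw [uIcc_of_le hx.le]; exact hec.mono Icc_subset_Ici_self)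
  have h1 : 0 ≤ ∫ s in (0 : ℝ)..x, (x - s) ^ (-α) * e s :=
    intervalIntegral.integral_nonneg hx.le fun s hs =>
      mul_nonneg (Real.rpow_nonneg (by linarith [hs.2]) _) (hshape hs.1 le_rfl).1
  have h2 : x * e x ≤ ∫ s in (0 : ℝ)..x, e s := by
    have := intervalIntegral.integral_mono_on hx.le intervalIntegrable_const hint
      fun s hs => (hshape hs.1 hs.2).2.1
    simpa using this
  rw [RelaxEq, one_mul, prim] at h
  have h3 : x * (μ * e x) ≤ x * (x ^ (-α) / (1 - α)) := by
    calc x * (μ * e x) = μ * (x * e x) := by ring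
      _ ≤ μ * ∫ s in (0 : ℝ)..x, e s := mul_le_mul_of_nonneg_left h2 hμ
      _ ≤ x ^ (1 - α) / (1 - α) := by linarith
      _ = x * (x ^ (-α) / (1 - α)) := by
        rw [sub_eq_add_neg 1 α, Real.rpow_add hx, Real.rpow_one]
        ring
  exact le_of_mul_le_mul_left h3 hx

/-- The integrated equation is evaluated at `2 * x`. There `e ≤ 1` on the first half and `e ≤ e x`
on the second, so the memory term falls short of `prim α (2 * x)` by at least `(1 - e x) * prim α
x`; this shortfall is `μ ∫ e ≤ 2 μ x`. -/
theorem relaxation_initial (hα : 0 < α) (hα' : α < 1) (hμ : 0 ≤ μ)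
    (hec : ContinuousOn e (Ici 0)) (he : ∀ x, 0 ≤ x → RelaxEq α μ 1 e x) {x : ℝ} (hx : 0 < x) :
    1 - e x ≤ 2 * (μ * x ^ α) := by
  have hshape := fun {a b : ℝ} (ha : 0 ≤ a) (hab : a ≤ b) => relaxation_shape hα hα' hμ hec he ha hab
  have h := he (2 * x) (by linarith)
  have hint : ∀ a b, 0 ≤ a → a ≤ b →
      IntervalIntegrable (fun s => (2 * x - s) ^ (-α) * e s) volume a b := fun a b ha hab =>
    intervalIntegrable_kernel_mul hα' _ (by
      rw [uIcc_of_le hab]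
      exact hec.mono fun s hs => ha.trans hs.1)
  have h1 : ∫ s in (0 : ℝ)..2 * x, e s ≤ 2 * x := by
    have := intervalIntegral.integral_mono_on (μ := volume) (g := fun _ => (1 : ℝ)) (f := e)
      (show (0 : ℝ) ≤ 2 * x by linarith)
      (ContinuousOn.intervalIntegrable (by
        rw [uIcc_of_le (by linarith)]; exact hec.mono Icc_subset_Ici_self))
      intervalIntegrable_const fun s hs => (hshape hs.1 le_rfl).2.2.1
    simpa using this
  have h2 : ∫ s in (0 : ℝ)..2 * x, (2 * x - s) ^ (-α) * e s ≤
      (prim α (2 * x) - prim α x) + e x * prim α x := by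
    rw [← intervalIntegral.integral_add_adjacent_intervals (hint 0 x le_rfl hx.le)
      (hint x (2 * x) hx.le (by linarith))]
    refine add_le_add ?_ ?_
    · refine (intervalIntegral.integral_mono_on hx.le (hint 0 x le_rfl hx.le)
        (intervalIntegrable_kernel hα' (2 * x) 0 x) fun s hs => ?_).trans (le_of_eq ?_)
      · exact mul_le_of_le_one_right (Real.rpow_nonneg (by linarith [hs.2]) _)
          (hshape hs.1 le_rfl).2.2.1
      · rw [integral_kernel hα', sub_zero, two_mul, add_sub_cancel_right]
    · refine (intervalIntegral.integral_mono_on (by linarith) (hint x (2 * x) hx.le (by linarith))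
        ((intervalIntegrable_kernel hα' (2 * x) x (2 * x)).const_mul (e x))
        fun s hs => ?_).trans (le_of_eq ?_)
      · rw [mul_comm]
        exact mul_le_mul_of_nonneg_right (hshape hx.le hs.1).2.1
          (Real.rpow_nonneg (by linarith [hs.2]) _)
      · rw [intervalIntegral.integral_const_mul, integral_kernel hα', sub_self, prim_zero hα',
          sub_zero, two_mul, add_sub_cancel_right]
  rw [RelaxEq, one_mul] at h
  have h3 : (1 - e x) * prim α x ≤ 2 * (μ * x) := by
    nlinarith [mul_le_mul_of_nonneg_left h1 hμ]
  have h4 : x ^ (1 - α) ≤ prim α x := by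
    rw [prim, le_div_iff₀ (by linarith)]
    nlinarith [Real.rpow_nonneg hx.le (1 - α)]
  have h5 : 0 ≤ 1 - e x := by linarith [(hshape hx.le le_rfl).2.2.1]
  have h6 : 0 < x ^ (1 - α) := Real.rpow_pos_of_pos hx _
  refine le_of_mul_le_mul_right ?_ h6
  calc (1 - e x) * x ^ (1 - α) ≤ 2 * (μ * x) := by nlinarith
    _ = 2 * (μ * x ^ α) * x ^ (1 - α) := by
      have : x = x ^ α * x ^ (1 - α) := by
        rw [← Real.rpow_add hx]
        simp
      rw [show 2 * (μ * x ^ α) * x ^ (1 - α) = 2 * (μ * (x ^ α * x ^ (1 - α))) by ring, ← this]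

/-- Interpolation between the linear bound and `1 - e x ≤ 1`; this is where the regularity `ν` of
the data enters. -/
theorem relaxation_initial_rpow (hα : 0 < α) (hα' : α < 1) (hμ : 0 ≤ μ)
    (hec : ContinuousOn e (Ici 0)) (he : ∀ x, 0 ≤ x → RelaxEq α μ 1 e x) {x ν : ℝ} (hx : 0 < x)
    (hν : 0 < ν) (hν' : ν ≤ 1) : 1 - e x ≤ 2 * (μ * x ^ α) ^ ν := by
  have h1 := relaxation_initial hα hα' hμ hec he hx
  have h2 := (relaxation_shape hα hα' hμ hec he hx.le le_rfl).1
  have hy : 0 ≤ μ * x ^ α := mul_nonneg hμ (Real.rpow_nonneg hx.le _)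
  rcases le_total (μ * x ^ α) 1 with h | h
  · rcases hy.eq_or_lt with h0 | h0
    · rw [← h0] at h1
      linarith [Real.rpow_nonneg hy ν]
    · have := Real.rpow_le_rpow_of_exponent_ge h0 h hν'
      rw [Real.rpow_one] at this
      linarith
  · linarith [Real.one_le_rpow h hν.le]

end Uniform

/-! ### Existence for the scalar equation by the Mittag-Leffler series -/

section MittagLeffler

variable {α lam : ℝ}

/-- The Gamma integral is cut down to `x > R`, where the power is at least `R ^ y`. As `R` is free,
the Gamma function outgrows every geometric sequence. -/
theorem rpow_mul_exp_neg_le_Gamma {y R : ℝ} (hy : 0 ≤ y) (hR : 0 ≤ R) :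
    R ^ y * Real.exp (-R) ≤ Real.Gamma (y + 1) := by
  have hint := Real.GammaIntegral_convergent (s := y + 1) (by linarith)
  rw [Real.Gamma_eq_integral (by linarith)]
  calc R ^ y * Real.exp (-R) = ∫ x in Ioi R, R ^ y * Real.exp (-x) := by
        rw [integral_const_mul, integral_exp_neg_Ioi]
    _ ≤ ∫ x in Ioi R, Real.exp (-x) * x ^ (y + 1 - 1) := by
        refine setIntegral_mono_on ((integrableOn_exp_neg_Ioi R).const_mul _)
          (hint.mono_set (Ioi_subset_Ioi hR)) measurableSet_Ioi fun x hx => ?_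
        rw [mul_comm, add_sub_cancel_right]
        exact mul_le_mul_of_nonneg_left (Real.rpow_le_rpow hR (le_of_lt hx) hy)
          (Real.exp_pos _).le
    _ ≤ ∫ x in Ioi 0, Real.exp (-x) * x ^ (y + 1 - 1) := by
        refine setIntegral_mono_set hint ?_ (ae_of_all _ (Ioi_subset_Ioi hR))
        refine (ae_restrict_iff' measurableSet_Ioi).2 (ae_of_all _ fun x hx => ?_)
        exact mul_nonneg (Real.exp_pos _).le (Real.rpow_nonneg (le_of_lt hx) _)

/-- A rescaled Beta integral, transferred from the complex Beta function. -/
theorem integral_kernel_rpow {p x : ℝ} (hα' : α < 1) (hp : 0 ≤ p) (hx : 0 < x) :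
    ∫ s in (0 : ℝ)..x, (x - s) ^ (-α) * s ^ p =
      x ^ (p + 1 - α) * (Real.Gamma (p + 1) * Real.Gamma (1 - α) / Real.Gamma (p + 1 + (1 - α))) := by
  have h := Complex.betaIntegral_scaled ((p + 1 : ℝ) : ℂ) ((1 - α : ℝ) : ℂ) hx
  rw [Complex.betaIntegral_eq_Gamma_mul_div _ _ (by simp; linarith) (by simp; linarith)] at h
  have h1 : ∫ s in (0 : ℝ)..x, (s : ℂ) ^ (((p + 1 : ℝ) : ℂ) - 1) *
      ((x : ℂ) - s) ^ (((1 - α : ℝ) : ℂ) - 1) =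
      ((∫ s in (0 : ℝ)..x, (x - s) ^ (-α) * s ^ p : ℝ) : ℂ) := by
    rw [← intervalIntegral.integral_ofReal]
    refine intervalIntegral.integral_congr fun s hs => ?_
    rw [uIcc_of_le hx.le] at hs
    rw [Complex.ofReal_mul, Complex.ofReal_cpow (by linarith [hs.2]), Complex.ofReal_cpow hs.1,
      mul_comm]
    push_cast
    congr 2 <;> ring
  rw [h1] at h
  have h2 : ((p + 1 : ℝ) : ℂ) + ((1 - α : ℝ) : ℂ) = ((p + 1 + (1 - α) : ℝ) : ℂ) := by
    push_cast; rfl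
  have h3 : ((p + 1 : ℝ) : ℂ) + ((1 - α : ℝ) : ℂ) - 1 = ((p + 1 - α : ℝ) : ℂ) := by
    push_cast; ring
  rw [h3, h2, Complex.Gamma_ofReal, Complex.Gamma_ofReal, Complex.Gamma_ofReal,
    ← Complex.ofReal_cpow hx.le] at h
  exact_mod_cast h

/-- The terms of the Mittag-Leffler series of `E_α(-λ s^α)`. -/
noncomputable def mlTerm (α lam : ℝ) (k : ℕ) (s : ℝ) : ℝ :=
  (-lam) ^ k / Real.Gamma (α * k + 1) * s ^ (α * k)

/-- The function `s ↦ E_α(-λ s^α)`. -/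
noncomputable def relaxation (α lam : ℝ) (s : ℝ) : ℝ := ∑' k, mlTerm α lam k s

theorem continuous_mlTerm (hα : 0 < α) (k : ℕ) : Continuous (mlTerm α lam k) :=
  (Real.continuous_rpow_const (by positivity)).const_mul _

theorem abs_mlTerm_le (hα : 0 < α) (hlam : 0 ≤ lam) (k : ℕ) {s x : ℝ} (hs : 0 ≤ s)
    (hsx : s ≤ x) : ‖mlTerm α lam k s‖ ≤ lam ^ k / Real.Gamma (α * k + 1) * x ^ (α * k) := by
  have hG : 0 < Real.Gamma (α * k + 1) := Real.Gamma_pos_of_pos (by positivity)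
  rw [mlTerm, norm_mul, norm_div, norm_pow, norm_neg, Real.norm_of_nonneg hlam,
    Real.norm_of_nonneg hG.le, Real.norm_of_nonneg (Real.rpow_nonneg hs _)]
  exact mul_le_mul_of_nonneg_left (Real.rpow_le_rpow hs hsx (by positivity)) (by positivity)

theorem summable_mlTerm_bound (hα : 0 < α) (hlam : 0 ≤ lam) {x : ℝ} (hx : 0 ≤ x) :
    Summable fun k : ℕ => lam ^ k / Real.Gamma (α * k + 1) * x ^ (α * k) := by
  -- With `R ^ α = y` the Gamma bound makes the series geometric with ratio `lam * x ^ α / y < 1`;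
  -- the `+ 1` keeps `y` positive when `lam * x ^ α` vanishes.
  set y : ℝ := 2 * (lam * x ^ α) + 1 with hy
  have hxα : 0 ≤ lam * x ^ α := mul_nonneg hlam (Real.rpow_nonneg hx _)
  have hy0 : 0 < y := by linarith
  set R : ℝ := y ^ α⁻¹
  have hR : 0 < R := Real.rpow_pos_of_pos hy0 _
  have hRα : R ^ α = y := Real.rpow_inv_rpow hy0.le hα.ne'
  have hq : lam * x ^ α / y < 1 := by
    rw [div_lt_one hy0]; linarith
  refine Summable.of_nonneg_of_le (fun k => ?_) (fun k => ?_)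
    ((summable_geometric_of_lt_one (by positivity) hq).mul_left (Real.exp R))
  · have hG : 0 < Real.Gamma (α * k + 1) := Real.Gamma_pos_of_pos (by positivity)
    positivity
  · have hG := rpow_mul_exp_neg_le_Gamma (y := α * k) (R := R) (by positivity) hR.le
    have hpos : 0 < R ^ (α * k) * Real.exp (-R) := by positivity
    rw [Real.rpow_mul hx, Real.rpow_natCast, div_mul_eq_mul_div, ← mul_pow]
    refine (div_le_div_of_nonneg_left (by positivity) hpos hG).trans (le_of_eq ?_)
    rw [Real.rpow_mul hR.le, Real.rpow_natCast, hRα, Real.exp_neg, div_pow]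
    field_simp

theorem hasSum_relaxation (hα : 0 < α) (hlam : 0 ≤ lam) {s : ℝ} (hs : 0 ≤ s) :
    HasSum (fun k => mlTerm α lam k s) (relaxation α lam s) :=
  (Summable.of_norm_bounded (summable_mlTerm_bound hα hlam hs)
    fun k => abs_mlTerm_le hα hlam k hs le_rfl).hasSum

theorem continuousOn_relaxation (hα : 0 < α) (hlam : 0 ≤ lam) :
    ContinuousOn (relaxation α lam) (Ici 0) := by
  intro x hx
  have h : ContinuousOn (relaxation α lam) (Icc 0 (x + 1)) :=
    continuousOn_tsum (fun k => (continuous_mlTerm hα k).continuousOn)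
      (summable_mlTerm_bound hα hlam (by linarith [mem_Ici.1 hx]))
      fun k s hs => abs_mlTerm_le hα hlam k hs.1 hs.2
  refine (h x ⟨hx, by linarith⟩).mono_of_mem_nhdsWithin ?_
  rw [← Ici_inter_Iic]
  exact inter_mem_nhdsWithin _ (Iic_mem_nhds (by linarith))

theorem relaxation_zero (hα : 0 < α) : relaxation α lam 0 = 1 := by
  rw [relaxation, tsum_eq_single 0]
  · simp [mlTerm]
  · intro k hk
    have : α * (k : ℝ) ≠ 0 := by positivity
    rw [mlTerm, Real.zero_rpow this, mul_zero]

/-- Integrating the series termwise, the memory integral of term `k + 1` cancels `μ` times the plain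
integral of term `k`. Only the memory integral of the constant term remains, and it is `prim α x`.
-/
theorem relaxation_relaxEq (hα : 0 < α) (hα' : α < 1) (hlam : 0 ≤ lam) {x : ℝ} (hx : 0 ≤ x) :
    RelaxEq α (Real.Gamma (1 - α) * lam) 1 (relaxation α lam) x := by
  rcases hx.eq_or_lt with rfl | hx0
  · simp [RelaxEq, prim_zero hα']
  have hsum := summable_mlTerm_bound hα hlam hx
  have hI : HasSum (fun k => ∫ s in (0 : ℝ)..x, (x - s) ^ (-α) * mlTerm α lam k s)
      (∫ s in (0 : ℝ)..x, (x - s) ^ (-α) * relaxation α lam s) := by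
    refine intervalIntegral.hasSum_integral_of_dominated_convergence
      (fun k s => (x - s) ^ (-α) * (lam ^ k / Real.Gamma (α * k + 1) * x ^ (α * k)))
      (fun k => ?_) (fun k => ae_of_all _ fun s hs => ?_)
      (ae_of_all _ fun s _ => hsum.mul_left _) ?_ (ae_of_all _ fun s hs => ?_)
    · exact ((intervalIntegrable_kernel_mul hα' x
        (continuous_mlTerm hα k).continuousOn).def').aestronglyMeasurable
    · rw [uIoc_of_le hx] at hs
      have h0 : 0 ≤ (x - s) ^ (-α) := Real.rpow_nonneg (by linarith [hs.2]) _
      rw [norm_mul, Real.norm_of_nonneg h0]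
      exact mul_le_mul_of_nonneg_left (abs_mlTerm_le hα hlam k hs.1.le hs.2) h0
    · simp only [tsum_mul_left]
      exact (intervalIntegrable_kernel hα' x 0 x).mul_const _
    · rw [uIoc_of_le hx] at hs
      exact (hasSum_relaxation hα hlam hs.1.le).mul_left _
  have hJ : HasSum (fun k => ∫ s in (0 : ℝ)..x, mlTerm α lam k s)
      (∫ s in (0 : ℝ)..x, relaxation α lam s) := by
    refine intervalIntegral.hasSum_integral_of_dominated_convergence
      (fun k s => lam ^ k / Real.Gamma (α * k + 1) * x ^ (α * k))
      (fun k => (continuous_mlTerm hα k).aestronglyMeasurable) (fun k => ae_of_all _ fun s hs => ?_)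
      (ae_of_all _ fun s _ => hsum) intervalIntegrable_const (ae_of_all _ fun s hs => ?_)
    · rw [uIoc_of_le hx] at hs
      exact abs_mlTerm_le hα hlam k hs.1.le hs.2
    · rw [uIoc_of_le hx] at hs
      exact hasSum_relaxation hα hlam hs.1.le
  have hIk : ∀ k : ℕ, ∫ s in (0 : ℝ)..x, (x - s) ^ (-α) * mlTerm α lam k s =
      Real.Gamma (1 - α) * (-lam) ^ k * x ^ (α * k + 1 - α) / Real.Gamma (α * k + 1 + (1 - α)) := by
    intro k
    have hG : 0 < Real.Gamma (α * k + 1) := Real.Gamma_pos_of_pos (by positivity)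
    simp only [mlTerm]
    rw [show (fun s => (x - s) ^ (-α) * ((-lam) ^ k / Real.Gamma (α * k + 1) * s ^ (α * k))) =
      fun s => (-lam) ^ k / Real.Gamma (α * k + 1) * ((x - s) ^ (-α) * s ^ (α * k)) by
        funext s; ring,
      intervalIntegral.integral_const_mul, integral_kernel_rpow hα' (by positivity) hx0]
    field_simp
  have hJk : ∀ k : ℕ, ∫ s in (0 : ℝ)..x, mlTerm α lam k s =
      (-lam) ^ k * x ^ (α * k + 1) / Real.Gamma (α * k + 1 + 1) := by
    intro k
    have hk : 0 < α * k + 1 := by positivity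
    have hG : 0 < Real.Gamma (α * k + 1) := Real.Gamma_pos_of_pos hk
    simp only [mlTerm]
    rw [intervalIntegral.integral_const_mul, integral_rpow (Or.inl (by linarith)),
      Real.zero_rpow hk.ne', sub_zero, Real.Gamma_add_one hk.ne']
    field_simp
  have hstep : ∀ k : ℕ, ∫ s in (0 : ℝ)..x, (x - s) ^ (-α) * mlTerm α lam (k + 1) s =
      -(Real.Gamma (1 - α) * lam) * ∫ s in (0 : ℝ)..x, mlTerm α lam k s := by
    intro k
    rw [hIk, hJk, show α * ((k + 1 : ℕ) : ℝ) + 1 - α = α * k + 1 by push_cast; ring,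
      show α * ((k + 1 : ℕ) : ℝ) + 1 + (1 - α) = α * k + 1 + 1 by push_cast; ring, pow_succ]
    ring
  have hfirst : ∫ s in (0 : ℝ)..x, (x - s) ^ (-α) * mlTerm α lam 0 s = prim α x := by
    have h1 : (1 - α) ≠ 0 := by linarith
    have hG : 0 < Real.Gamma (1 - α) := Real.Gamma_pos_of_pos (by linarith)
    rw [hIk, prim]
    simp only [Nat.cast_zero, mul_zero, zero_add, pow_zero, mul_one]
    rw [add_comm (1 : ℝ), Real.Gamma_add_one h1]
    field_simp
  rw [RelaxEq, ← hI.tsum_eq, hI.summable.tsum_eq_zero_add, hfirst]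
  simp only [hstep]
  rw [tsum_mul_left, hJ.tsum_eq]
  ring

end MittagLeffler

/-! ### Expansions in the Hilbert basis -/

section Basis

variable {X : Type*} [NormedAddCommGroup X] [InnerProductSpace ℝ X]

theorem basis_ext (φ : HilbertBasis ℕ ℝ X) {x y : X}
    (h : ∀ n, inner ℝ x (φ n) = inner ℝ y (φ n)) : x = y := by
  apply φ.repr.injective
  ext n
  rw [φ.repr_apply_apply, φ.repr_apply_apply, real_inner_comm, h, real_inner_comm]

theorem hasSum_coeff_sq (φ : HilbertBasis ℕ ℝ X) (x : X) :
    HasSum (fun n => inner ℝ x (φ n) ^ 2) (‖x‖ ^ 2) := by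
  have h := φ.hasSum_inner_mul_inner x x
  rw [real_inner_self_eq_norm_sq] at h
  have h' : (fun n => inner ℝ x (φ n) ^ 2) = fun n => inner ℝ x (φ n) * inner ℝ (φ n) x := by
    funext n
    rw [real_inner_comm x (φ n), sq]
  rw [h']
  exact h

theorem exists_coeff (φ : HilbertBasis ℕ ℝ X) {f : ℕ → ℝ} (hf : Summable fun n => f n ^ 2) :
    ∃ x : X, ∀ n, inner ℝ x (φ n) = f n := by
  have hmem : Memℓp f 2 := by
    rw [memℓp_gen_iff (by norm_num)]
    simpa using hf
  refine ⟨φ.repr.symm ⟨f, hmem⟩, fun n => ?_⟩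
  rw [real_inner_comm, ← φ.repr_apply_apply, LinearIsometryEquiv.apply_symm_apply]

theorem norm_le_of_coeff_le (φ : HilbertBasis ℕ ℝ X) {x : X} {g : ℕ → ℝ} {K : ℝ} (hK : 0 ≤ K)
    (h : ∀ n, |inner ℝ x (φ n)| ≤ K * |g n|) (hg : Summable fun n => g n ^ 2) :
    ‖x‖ ≤ K * Real.sqrt (∑' n, g n ^ 2) := by
  refine le_of_sq_le_sq ?_ (by positivity)
  rw [mul_pow, Real.sq_sqrt (tsum_nonneg fun n => sq_nonneg _), ← (hasSum_coeff_sq φ x).tsum_eq,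
    ← tsum_mul_left]
  refine (hasSum_coeff_sq φ x).summable.tsum_le_tsum (fun n => ?_) (hg.mul_left _)
  rw [← sq_abs, ← sq_abs (g n), ← mul_pow]
  exact pow_le_pow_left₀ (abs_nonneg _) (h n) 2

/-- Coefficientwise continuity together with a square summable bound gives continuity. -/
theorem continuousOn_of_coeff (φ : HilbertBasis ℕ ℝ X) {u : ℝ → X} {s : Set ℝ} {g : ℕ → ℝ}
    (hg : Summable fun n => g n ^ 2) (hbound : ∀ t ∈ s, ∀ n, |inner ℝ (u t) (φ n)| ≤ |g n|)
    (hc : ∀ n, ContinuousOn (fun t => (inner ℝ (u t) (φ n) : ℝ)) s) : ContinuousOn u s := by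
  intro t₀ ht₀
  rw [ContinuousWithinAt, tendsto_iff_norm_sub_tendsto_zero]
  have hsq : Tendsto (fun t => ‖u t - u t₀‖ ^ 2) (𝓝[s] t₀) (𝓝 0) := by
    have h := tendsto_tsum_of_dominated_convergence (𝓕 := 𝓝[s] t₀)
      (f := fun t n => (inner ℝ (u t - u t₀) (φ n) : ℝ) ^ 2) (g := fun _ => (0 : ℝ))
      (bound := fun n => 4 * g n ^ 2) (hg.mul_left _) (fun n => ?_) ?_
    · simpa [(hasSum_coeff_sq φ _).tsum_eq] using h
    · have h1 := ((hc n t₀ ht₀).sub_const (inner ℝ (u t₀) (φ n))).pow 2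
      simpa [inner_sub_left] using h1
    · refine eventually_nhdsWithin_of_forall fun t ht n => ?_
      rw [Real.norm_of_nonneg (sq_nonneg _), inner_sub_left, ← sq_abs]
      have h1 := hbound t ht n
      have h2 := hbound t₀ ht₀ n
      have h3 := abs_sub (inner ℝ (u t) (φ n)) (inner ℝ (u t₀) (φ n))
      calc _ ≤ (2 * |g n|) ^ 2 := pow_le_pow_left₀ (abs_nonneg _) (by linarith) 2
        _ = _ := by rw [mul_pow, sq_abs]; norm_num
  have h := (Real.continuous_sqrt.tendsto 0).comp hsq
  simpa [Function.comp_def, Real.sqrt_sq (norm_nonneg _)] using h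

variable {A : X →ₗ.[ℝ] X}

/-- Symmetry is assumed for the inverse, so it is applied to `A x` and an eigenvector and translated
back. -/
theorem IsAdmissible.inner_apply_eq (hA : IsAdmissible A) (S : SpectralDecomposition A)
    (x : A.domain) (n : ℕ) : inner ℝ (A x) (S.φ n) = S.lam n * inner ℝ (x : X) (S.φ n) := by
  obtain ⟨B, hBA, -, -, hpos⟩ := hA.exists_inverse
  have h1 : B (S.lam n • S.φ n) = S.φ n := by
    rw [← S.apply_eq n, hBA]
  have h2 : inner ℝ (B (A x)) (S.lam n • S.φ n) = inner ℝ (A x) (B (S.lam n • S.φ n)) :=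
    hpos.1 (A x) (S.lam n • S.φ n)
  rw [hBA, h1, real_inner_smul_right] at h2
  exact h2.symm

theorem IsAdmissible.exists_apply_eq (hA : IsAdmissible A) (S : SpectralDecomposition A)
    {x w : X} (h : ∀ n, inner ℝ w (S.φ n) = S.lam n * inner ℝ x (S.φ n)) :
    ∃ hx : x ∈ A.domain, A ⟨x, hx⟩ = w := by
  obtain ⟨B, hBA, hAB, -, hpos⟩ := hA.exists_inverse
  have hBw : B w = x := by
    refine basis_ext S.φ fun n => ?_
    have h1 : B (S.lam n • S.φ n) = S.φ n := by
      rw [← S.apply_eq n, hBA]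
    have h2 : inner ℝ (B w) (S.lam n • S.φ n) = inner ℝ w (B (S.lam n • S.φ n)) :=
      hpos.1 w (S.lam n • S.φ n)
    rw [h1, real_inner_smul_right, h] at h2
    exact mul_left_cancel₀ (S.lam_pos n).ne' h2
  rw [← hBw]
  exact hAB w

end Basis

/-! ### The continuous problem -/

section Continuous

variable {X : Type*} [NormedAddCommGroup X] [InnerProductSpace ℝ X] {α : ℝ}

theorem fracInt_eq (v : ℝ → X) (t : ℝ) :
    fracInt (1 - α) v t = (Real.Gamma (1 - α))⁻¹ • ∫ s in (0 : ℝ)..t, (t - s) ^ (-α) • v s := by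
  rw [fracInt, show 1 - α - 1 = -α by ring]

theorem intervalIntegrable_kernel_smul (hα' : α < 1) {t : ℝ} (ht : 0 ≤ t) {v : ℝ → X}
    (hv : ContinuousOn v (Icc 0 t)) :
    IntervalIntegrable (fun s => (t - s) ^ (-α) • v s) volume 0 t := by
  rw [intervalIntegrable_iff_integrableOn_Icc_of_le ht]
  have h := intervalIntegrable_kernel hα' t 0 t
  rw [intervalIntegrable_iff_integrableOn_Icc_of_le ht] at h
  exact h.smul_continuousOn hv isCompact_Icc

theorem inner_fracInt [CompleteSpace X] {t : ℝ} {v : ℝ → X}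
    (hv : IntervalIntegrable (fun s => (t - s) ^ (-α) • v s) volume 0 t) (y : X) :
    inner ℝ (fracInt (1 - α) v t) y =
      (Real.Gamma (1 - α))⁻¹ * ∫ s in (0 : ℝ)..t, (t - s) ^ (-α) * inner ℝ (v s) y := by
  rw [fracInt_eq, real_inner_smul_left, real_inner_comm]
  have h := (innerSL ℝ y).intervalIntegral_comp_comm hv
  simp only [innerSL_apply_apply, real_inner_smul_right] at h
  rw [← h]
  simp only [real_inner_comm]

variable {A : X →ₗ.[ℝ] X}

theorem Gamma_mul_lam_pos (hα' : α < 1) (S : SpectralDecomposition A) (n : ℕ) :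
    0 < Real.Gamma (1 - α) * S.lam n :=
  mul_pos (Real.Gamma_pos_of_pos (by linarith)) (S.lam_pos n)

/-- The coefficients of a solution solve the scalar equation. -/
theorem IsSolution.relaxEq [CompleteSpace X] (hα' : α < 1) (hA : IsAdmissible A)
    (S : SpectralDecomposition A) {T : ℝ} {u₀ : X} {u : ℝ → X} (hu : IsSolution A α T u₀ u)
    (n : ℕ) {x : ℝ} (hx : x ∈ Icc 0 T) :
    RelaxEq α (Real.Gamma (1 - α) * S.lam n) (inner ℝ u₀ (S.φ n))
      (fun s => inner ℝ (u s) (S.φ n)) x := by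
  have hG : 0 < Real.Gamma (1 - α) := Real.Gamma_pos_of_pos (by linarith)
  have hdc : ContinuousOn (fun s => u s - u₀) (Icc 0 T) := hu.continuousOn.sub continuousOn_const
  have hvc : ContinuousOn (fun s => (inner ℝ (u s) (S.φ n) : ℝ)) (Icc 0 T) :=
    hu.continuousOn.inner continuousOn_const
  set g : ℝ → ℝ := fun y => inner ℝ (fracInt (1 - α) (fun s => u s - u₀) y) (S.φ n) with hg
  have hgeq : ∀ y ∈ Icc 0 T, g y = (Real.Gamma (1 - α))⁻¹ *
      ∫ s in (0 : ℝ)..y, (y - s) ^ (-α) * inner ℝ (u s - u₀) (S.φ n) := fun y hy =>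
    inner_fracInt (intervalIntegrable_kernel_smul hα' hy.1
      (hdc.mono (Icc_subset_Icc le_rfl hy.2))) _
  have hderiv : ∀ y ∈ Ioc 0 T,
      HasDerivWithinAt g (-(S.lam n * inner ℝ (u y) (S.φ n))) (Icc 0 T) y := by
    intro y hy
    obtain ⟨h, hd⟩ := hu.equation y hy
    have h1 := hd.inner ℝ (hasDerivWithinAt_const y (Icc 0 T) (S.φ n))
    rw [inner_zero_right, zero_add, inner_neg_left, hA.inner_apply_eq S] at h1
    exact h1
  have hg0 : g 0 = 0 := by
    rw [hgeq 0 ⟨le_rfl, hx.1.trans hx.2⟩, intervalIntegral.integral_same, mul_zero]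
  -- The equation says nothing at time zero; continuity there comes from the bound of the fractional
  -- integral by a multiple of `prim α y`, which tends to zero.
  have hcont : ContinuousOn g (Icc 0 T) := by
    intro y hy
    rcases hy.1.eq_or_lt with rfl | hy0
    · obtain ⟨K, hK⟩ := isCompact_Icc.exists_bound_of_continuousOn
        (hdc.inner (𝕜 := ℝ) (continuousOn_const (c := S.φ n)))
      rw [ContinuousWithinAt, hg0]
      have hlim : Tendsto (fun y => (Real.Gamma (1 - α))⁻¹ * (K * prim α y)) (𝓝[Icc 0 T] 0)
          (𝓝 0) := by
        have h1 : Continuous fun y => (Real.Gamma (1 - α))⁻¹ * (K * prim α y) :=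
          continuous_const.mul (continuous_const.mul (continuous_prim hα'))
        have h2 := (h1.tendsto 0).mono_left (nhdsWithin_le_nhds (s := Icc 0 T))
        simpa [prim_zero hα'] using h2
      refine squeeze_zero_norm' (eventually_nhdsWithin_of_forall fun z hz => ?_) hlim
      rw [hgeq z hz, norm_mul, Real.norm_of_nonneg (inv_pos.2 hG).le]
      refine mul_le_mul_of_nonneg_left ?_ (inv_pos.2 hG).le
      have := abs_integral_kernel_mul_le hα' hz.1 le_rfl
        (w := fun s => inner ℝ (u s - u₀) (S.φ n)) (ε := K)
        fun s hs => hK s ⟨hs.1, hs.2.trans hz.2⟩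
      rwa [sub_self, prim_zero hα', sub_zero, sub_zero] at this
    · exact (hderiv y ⟨hy0, hy.2⟩).continuousWithinAt
  have hsub : Icc 0 x ⊆ Icc 0 T := Icc_subset_Icc le_rfl hx.2
  have hvx : ContinuousOn (fun s => (inner ℝ (u s) (S.φ n) : ℝ)) (uIcc 0 x) := by
    rw [uIcc_of_le hx.1]; exact hvc.mono hsub
  have hftc := intervalIntegral.integral_eq_sub_of_hasDeriv_right_of_le hx.1
    (hcont.mono hsub) (fun y hy => ((hderiv y ⟨hy.1, hy.2.le.trans hx.2⟩).hasDerivAt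
      (Icc_mem_nhds hy.1 (hy.2.trans_le hx.2))).hasDerivWithinAt)
    ((hvx.intervalIntegrable.const_mul (S.lam n)).neg)
  have hI : ∫ s in (0 : ℝ)..x, (x - s) ^ (-α) * inner ℝ (u s - u₀) (S.φ n) =
      (∫ s in (0 : ℝ)..x, (x - s) ^ (-α) * inner ℝ (u s) (S.φ n)) -
        inner ℝ u₀ (S.φ n) * prim α x := by
    simp only [inner_sub_left, mul_sub]
    rw [intervalIntegral.integral_sub (intervalIntegrable_kernel_mul hα' x hvx)
      ((intervalIntegrable_kernel hα' x 0 x).mul_const _), intervalIntegral.integral_mul_const,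
      integral_kernel hα', sub_self, prim_zero hα', sub_zero, sub_zero, mul_comm (prim α x)]
  rw [hg0, sub_zero, hgeq x hx, hI, intervalIntegral.integral_neg,
    intervalIntegral.integral_const_mul] at hftc
  rw [RelaxEq]
  field_simp at hftc
  linarith

/-- The coefficients of a solution are multiples of Mittag-Leffler functions. -/
theorem IsSolution.coeff_eq [CompleteSpace X] (hα : 0 < α) (hα' : α < 1) (hA : IsAdmissible A)
    (S : SpectralDecomposition A) {T : ℝ} {u₀ : X} {u : ℝ → X} (hu : IsSolution A α T u₀ u)
    (n : ℕ) {x : ℝ} (hx : x ∈ Ico 0 T) :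
    inner ℝ (u x) (S.φ n) = relaxation α (S.lam n) x * inner ℝ u₀ (S.φ n) := by
  have hμ := Gamma_mul_lam_pos hα' S n
  have hvc : ContinuousOn (fun s => (inner ℝ (u s) (S.φ n) : ℝ)) (Icc 0 T) :=
    hu.continuousOn.inner continuousOn_const
  have hec : ContinuousOn (relaxation α (S.lam n)) (Icc 0 T) :=
    (continuousOn_relaxation hα (S.lam_pos n).le).mono Icc_subset_Ici_self
  -- The difference from the Mittag-Leffler solution solves the scalar equation with zero initial
  -- value.
  have h := RelaxEq.eq_zero (v := fun s => inner ℝ (u s) (S.φ n) -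
    inner ℝ u₀ (S.φ n) * relaxation α (S.lam n) s) hα hα' hμ.le
    (hvc.sub (continuousOn_const.mul hec)) (fun y hy => ?_) x hx
  · linarith
  · have h1 := hu.relaxEq hα' hA S n hy
    have h2 := relaxation_relaxEq hα hα' (S.lam_pos n).le hy.1
    have hsub : uIcc 0 y ⊆ Icc 0 T := by
      rw [uIcc_of_le hy.1]; exact Icc_subset_Icc le_rfl hy.2
    rw [RelaxEq] at h1 h2 ⊢
    simp only [mul_sub, mul_left_comm _ (inner ℝ u₀ (S.φ n))]
    rw [intervalIntegral.integral_sub (intervalIntegrable_kernel_mul hα' y (hvc.mono hsub))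
        ((intervalIntegrable_kernel_mul hα' y (hec.mono hsub)).const_mul _),
      intervalIntegral.integral_sub (hvc.mono hsub).intervalIntegrable
        ((hec.mono hsub).intervalIntegrable.const_mul _),
      intervalIntegral.integral_const_mul, intervalIntegral.integral_const_mul]
    linear_combination h1 - inner ℝ u₀ (S.φ n) * h2

/-- The constant in the decay estimate for the Mittag-Leffler function. -/
noncomputable def decayConst (α : ℝ) : ℝ := 1 / ((1 - α) * Real.Gamma (1 - α))

theorem decayConst_nonneg (hα' : α < 1) : 0 ≤ decayConst α :=
  one_div_nonneg.2 (mul_pos (by linarith) (Real.Gamma_pos_of_pos (by linarith))).le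

theorem abs_relaxation_le_one (hα : 0 < α) (hα' : α < 1) {lam : ℝ} (hlam : 0 < lam) {x : ℝ}
    (hx : 0 ≤ x) : |relaxation α lam x| ≤ 1 := by
  have hG : 0 < Real.Gamma (1 - α) := Real.Gamma_pos_of_pos (by linarith)
  have h := relaxation_shape hα hα' (mul_pos hG hlam).le (continuousOn_relaxation hα hlam.le)
    (fun x hx => relaxation_relaxEq hα hα' hlam.le hx) hx le_rfl
  rw [abs_of_nonneg h.1]
  exact h.2.2.1

theorem abs_mul_relaxation_le (hα : 0 < α) (hα' : α < 1) {lam : ℝ} (hlam : 0 < lam) {x : ℝ}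
    (hx : 0 < x) : |lam * relaxation α lam x| ≤ decayConst α * x ^ (-α) := by
  have hG : 0 < Real.Gamma (1 - α) := Real.Gamma_pos_of_pos (by linarith)
  have hec := continuousOn_relaxation hα hlam.le
  have heq := fun x (hx : 0 ≤ x) => relaxation_relaxEq hα hα' hlam.le hx
  have h0 := (relaxation_shape hα hα' (mul_pos hG hlam).le hec heq hx.le le_rfl).1
  have h := relaxation_decay hα hα' (mul_pos hG hlam).le hec heq hx
  have h1 : (1 - α) ≠ 0 := by linarith
  rw [abs_of_nonneg (mul_nonneg hlam.le h0), ← mul_le_mul_iff_right₀ hG, ← mul_assoc]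
  refine h.trans (le_of_eq ?_)
  rw [decayConst]
  field_simp

/-- The function with coefficients `E_α(-λₙ t^α) (u₀, φₙ)`. -/
theorem exists_solution_curve (hα : 0 < α) (hα' : α < 1) (S : SpectralDecomposition A) (u₀ : X) :
    ∃ u : ℝ → X, ContinuousOn u (Ici 0) ∧ ∀ t, 0 ≤ t → ∀ n, inner ℝ (u t) (S.φ n) =
      relaxation α (S.lam n) t * inner ℝ u₀ (S.φ n) := by
  have hu0 := (hasSum_coeff_sq S.φ u₀).summable
  have habs := fun n (x : ℝ) (hx : 0 ≤ x) => abs_relaxation_le_one hα hα' (S.lam_pos n) hx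
  choose u hu using fun t : ℝ => exists_coeff S.φ
    (f := fun n => relaxation α (S.lam n) (max t 0) * inner ℝ u₀ (S.φ n)) (by
      refine hu0.of_nonneg_of_le (fun n => sq_nonneg _) fun n => ?_
      rw [mul_pow]
      refine mul_le_of_le_one_left (sq_nonneg _) ?_
      rw [← sq_abs]
      exact pow_le_one₀ (abs_nonneg _) (habs n _ (le_max_right _ _)))
  have hupos : ∀ t, 0 ≤ t → ∀ n, inner ℝ (u t) (S.φ n) =
      relaxation α (S.lam n) t * inner ℝ u₀ (S.φ n) := fun t ht n => by
    rw [hu, max_eq_left ht]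
  refine ⟨u, continuousOn_of_coeff S.φ hu0 (fun t ht n => ?_) fun n => ?_, hupos⟩
  · rw [hupos t ht, abs_mul]
    exact mul_le_of_le_one_left (abs_nonneg _) (habs n t ht)
  · exact ((continuousOn_relaxation hα (S.lam_pos n).le).mul continuousOn_const).congr
      fun t ht => hupos t ht n

/-- The function with coefficients `λₙ E_α(-λₙ t^α) (u₀, φₙ)`. -/
theorem exists_apply_curve [CompleteSpace X] (hα : 0 < α) (hα' : α < 1) (S : SpectralDecomposition A) (u₀ : X) :
    ∃ w : ℝ → X, ContinuousOn w (Ioi 0) ∧ (∀ t, 0 ≤ t → IntervalIntegrable w volume 0 t) ∧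
      ∀ t, 0 < t → ∀ n, inner ℝ (w t) (S.φ n) =
        S.lam n * relaxation α (S.lam n) t * inner ℝ u₀ (S.φ n) := by
  have hu0 := (hasSum_coeff_sq S.φ u₀).summable
  have hC := decayConst_nonneg hα'
  have hdecay := fun n (x : ℝ) (hx : 0 < x) => abs_mul_relaxation_le hα hα' (S.lam_pos n) hx
  choose w hw using fun t : ℝ => exists_coeff S.φ
    (f := fun n => if 0 < t then S.lam n * relaxation α (S.lam n) t * inner ℝ u₀ (S.φ n) else 0) (by
      split_ifs with ht
      · refine (hu0.mul_left ((decayConst α * t ^ (-α)) ^ 2)).of_nonneg_of_le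
          (fun n => sq_nonneg _) fun n => ?_
        rw [mul_pow]
        refine mul_le_mul_of_nonneg_right ?_ (sq_nonneg _)
        rw [← sq_abs]
        exact pow_le_pow_left₀ (abs_nonneg _) (hdecay n t ht) 2
      · simp)
  have hwpos : ∀ t, 0 < t → ∀ n, inner ℝ (w t) (S.φ n) =
      S.lam n * relaxation α (S.lam n) t * inner ℝ u₀ (S.φ n) := fun t ht n => by
    rw [hw, if_pos ht]
  have hwnorm : ∀ t, 0 < t → ‖w t‖ ≤ decayConst α * t ^ (-α) *
      Real.sqrt (∑' n, (inner ℝ u₀ (S.φ n)) ^ 2) := by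
    intro t ht
    refine norm_le_of_coeff_le S.φ (mul_nonneg hC (Real.rpow_nonneg ht.le _)) (fun n => ?_) hu0
    rw [hwpos t ht, abs_mul]
    exact mul_le_mul_of_nonneg_right (hdecay n t ht) (abs_nonneg _)
  have hwc : ContinuousOn w (Ioi 0) := by
    intro t ht
    have ht' : 0 < t := ht
    obtain ⟨K, hK⟩ : ∃ K, K = decayConst α * (t / 2) ^ (-α) := ⟨_, rfl⟩
    -- Away from zero the decay bound is uniform in time, so dominated convergence applies.
    have h1 : ContinuousOn w (Ioi (t / 2)) := by
      refine continuousOn_of_coeff S.φ (g := fun n => K * inner ℝ u₀ (S.φ n)) ?_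
        (fun s hs n => ?_) fun n => ?_
      · simpa only [mul_pow] using hu0.mul_left (K ^ 2)
      · have hs' : t / 2 < s := hs
        have hs0 : 0 < s := by linarith
        have h2 : |S.lam n * relaxation α (S.lam n) s| ≤ |K| := by
          rw [hK]
          exact ((hdecay n s hs0).trans (mul_le_mul_of_nonneg_left
            (rpow_neg_le_rpow_neg hα (by linarith) hs'.le) hC)).trans (le_abs_self _)
        rw [hwpos s hs0]
        simp only [abs_mul] at h2 ⊢
        exact mul_le_mul_of_nonneg_right h2 (abs_nonneg _)
      · have hsub : Ioi (t / 2) ⊆ Ici 0 := fun s hs => by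
          have hs' : t / 2 < s := hs
          exact mem_Ici.2 (by linarith)
        refine ((continuousOn_const.mul
          ((continuousOn_relaxation hα (S.lam_pos n).le).mono hsub)).mul continuousOn_const).congr
          fun s hs => hwpos s ?_ n
        have hs' : t / 2 < s := hs
        linarith
    exact (h1.continuousAt (Ioi_mem_nhds (by linarith))).continuousWithinAt
  refine ⟨w, hwc, fun t ht => ?_, hwpos⟩
  rw [intervalIntegrable_iff_integrableOn_Ioc_of_le ht]
  have h1 : IntegrableOn (fun s : ℝ => decayConst α * s ^ (-α) *
      Real.sqrt (∑' n, (inner ℝ u₀ (S.φ n)) ^ 2)) (Ioc 0 t) := by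
    rw [← intervalIntegrable_iff_integrableOn_Ioc_of_le ht]
    exact ((intervalIntegral.intervalIntegrable_rpow' (by linarith)).const_mul _).mul_const _
  refine h1.mono' ((hwc.mono Ioc_subset_Ioi_self).aestronglyMeasurable measurableSet_Ioc) ?_
  exact (ae_restrict_iff' measurableSet_Ioc).2 (ae_of_all _ fun s hs => hwnorm s hs.1)

/-- The integrated equation for a function with the coefficients of the solution. -/
theorem fracInt_solution_curve [CompleteSpace X] (hα : 0 < α) (hα' : α < 1) (S : SpectralDecomposition A) {u₀ : X}
    {u w : ℝ → X} (huc : ContinuousOn u (Ici 0))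
    (hu : ∀ t, 0 ≤ t → ∀ n, inner ℝ (u t) (S.φ n) =
      relaxation α (S.lam n) t * inner ℝ u₀ (S.φ n))
    (hwint : ∀ t, 0 ≤ t → IntervalIntegrable w volume 0 t)
    (hw : ∀ t, 0 < t → ∀ n, inner ℝ (w t) (S.φ n) =
      S.lam n * relaxation α (S.lam n) t * inner ℝ u₀ (S.φ n)) {t : ℝ} (ht : 0 ≤ t) :
    fracInt (1 - α) (fun s => u s - u₀) t = -∫ s in (0 : ℝ)..t, w s := by
  have hG : 0 < Real.Gamma (1 - α) := Real.Gamma_pos_of_pos (by linarith)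
  refine basis_ext S.φ fun n => ?_
  have hec : ContinuousOn (relaxation α (S.lam n)) (uIcc 0 t) := by
    rw [uIcc_of_le ht]
    exact (continuousOn_relaxation hα (S.lam_pos n).le).mono Icc_subset_Ici_self
  rw [inner_fracInt (v := fun s => u s - u₀) (intervalIntegrable_kernel_smul hα' ht
    ((huc.mono Icc_subset_Ici_self).sub continuousOn_const)), inner_neg_left]
  have h1 : inner ℝ (∫ s in (0 : ℝ)..t, w s) (S.φ n) =
      S.lam n * (∫ s in (0 : ℝ)..t, relaxation α (S.lam n) s) * inner ℝ u₀ (S.φ n) := by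
    rw [real_inner_comm]
    have h := (innerSL ℝ (S.φ n)).intervalIntegral_comp_comm (hwint t ht)
    simp only [innerSL_apply_apply] at h
    rw [← h, ← intervalIntegral.integral_const_mul, ← intervalIntegral.integral_mul_const]
    refine intervalIntegral.integral_congr_ae (ae_of_all _ fun s hs => ?_)
    rw [uIoc_of_le ht] at hs
    rw [real_inner_comm, hw s hs.1]
  have h2 : ∫ s in (0 : ℝ)..t, (t - s) ^ (-α) * inner ℝ (u s - u₀) (S.φ n) =
      ((∫ s in (0 : ℝ)..t, (t - s) ^ (-α) * relaxation α (S.lam n) s) - prim α t) *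
        inner ℝ u₀ (S.φ n) := by
    have h3 : prim α t = ∫ s in (0 : ℝ)..t, (t - s) ^ (-α) := by
      rw [integral_kernel hα', sub_self, prim_zero hα', sub_zero, sub_zero]
    rw [h3, ← intervalIntegral.integral_sub (intervalIntegrable_kernel_mul hα' t hec)
      (intervalIntegrable_kernel hα' t 0 t), ← intervalIntegral.integral_mul_const]
    refine intervalIntegral.integral_congr fun s hs => ?_
    rw [uIcc_of_le ht] at hs
    rw [inner_sub_left, hu s hs.1]
    ring
  have h4 := relaxation_relaxEq hα hα' (S.lam_pos n).le ht
  rw [RelaxEq] at h4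
  rw [h1, h2]
  have h5 : (∫ s in (0 : ℝ)..t, (t - s) ^ (-α) * relaxation α (S.lam n) s) - prim α t =
      -(Real.Gamma (1 - α) * S.lam n * ∫ s in (0 : ℝ)..t, relaxation α (S.lam n) s) := by
    linarith
  rw [h5]
  field_simp

/-- Existence for the continuous problem. -/
theorem exists_isSolution [CompleteSpace X] (hα : 0 < α) (hα' : α < 1) (hA : IsAdmissible A)
    (S : SpectralDecomposition A) (T : ℝ) (u₀ : X) : ∃ u, IsSolution A α T u₀ u := by
  obtain ⟨u, huc, hu⟩ := exists_solution_curve hα hα' S u₀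
  obtain ⟨w, hwc, hwint, hw⟩ := exists_apply_curve hα hα' S u₀
  have hid := fun t (ht : 0 ≤ t) => fracInt_solution_curve hα hα' S huc hu hwint hw ht
  refine ⟨u, huc.mono Icc_subset_Ici_self, ?_, fun t ht => ?_⟩
  · refine basis_ext S.φ fun n => ?_
    rw [hu 0 le_rfl, relaxation_zero hα, one_mul]
  · obtain ⟨h, hAu⟩ := hA.exists_apply_eq S (x := u t) (w := w t) fun n => by
      rw [hw t ht.1, hu t ht.1.le, mul_assoc]
    refine ⟨h, ?_⟩
    rw [hAu]
    -- The fractional integral equals `-∫ w` with `w = A u` continuous for positive times, so the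
    -- equation is the fundamental theorem of calculus.
    have hd := (intervalIntegral.integral_hasDerivAt_right (hwint t ht.1.le)
      (hwc.stronglyMeasurableAtFilter isOpen_Ioi t ht.1)
      (hwc.continuousAt (Ioi_mem_nhds ht.1))).neg.hasDerivWithinAt (s := Icc 0 T)
    exact hd.congr (fun x hx => hid x hx.1) (hid t ht.1.le)

end Continuous

/-! ### The scheme in terms of cell values -/

section Scheme

variable {X : Type*} [NormedAddCommGroup X] [InnerProductSpace ℝ X] {α : ℝ}

theorem ae_eq_of_eq_Ioo {E : Type*} {f g : ℝ → E} {a b : ℝ} (hab : a ≤ b)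
    (h : ∀ x ∈ Ioo a b, f x = g x) : f =ᵐ[volume.restrict (uIoc a b)] g := by
  rw [uIoc_of_le hab]
  refine (ae_restrict_iff' measurableSet_Ioc).2 ?_
  have hb : ∀ᵐ x : ℝ, x ≠ b := by simp [ae_iff]
  filter_upwards [hb] with x hx hx'
  exact h x ⟨hx'.1, lt_of_le_of_ne hx'.2 hx⟩

theorem intervalIntegrable_of_eq_Ioo {E : Type*} [NormedAddCommGroup E] {f g : ℝ → E} {a b : ℝ} (hab : a ≤ b)
    (h : ∀ x ∈ Ioo a b, f x = g x) (hg : IntervalIntegrable g volume a b) :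
    IntervalIntegrable f volume a b := by
  rw [intervalIntegrable_iff] at hg ⊢
  exact hg.congr (ae_eq_of_eq_Ioo hab h).symm

theorem integral_eq_of_eq_Ioo {E : Type*} [NormedAddCommGroup E] [NormedSpace ℝ E] {f g : ℝ → E}
    {a b : ℝ} (hab : a ≤ b)
    (h : ∀ x ∈ Ioo a b, f x = g x) : ∫ x in a..b, f x = ∫ x in a..b, g x :=
  intervalIntegral.integral_congr_ae
    ((ae_restrict_iff' measurableSet_uIoc).1 (ae_eq_of_eq_Ioo hab h))

variable {t : ℕ → ℝ} {J : ℕ}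

/-- `U` takes the value `c j` on the `j`-th mesh cell, for all `j < J`. -/
def HasCellValues {E : Type*} (t : ℕ → ℝ) (J : ℕ) (U : ℝ → E) (c : ℕ → E) : Prop :=
  ∀ j < J, ∀ x ∈ Ioo (t j) (t (j + 1)), U x = c j

theorem exists_hasCellValues {E : Type*} [Inhabited E] (ht : StrictMono t) (J : ℕ) (c : ℕ → E) :
    ∃ U : ℝ → E, HasCellValues t J U c := by
  classical
  refine ⟨fun x => if h : ∃ m, x ∈ Ioo (t m) (t (m + 1)) then c h.choose else default,
    fun j _ x hx => ?_⟩
  have hex : ∃ m, x ∈ Ioo (t m) (t (m + 1)) := ⟨j, hx⟩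
  refine (dif_pos hex).trans (congrArg c ?_)
  have h := hex.choose_spec
  by_contra hne
  rcases lt_or_gt_of_ne hne with hlt | hlt
  · have := ht.monotone (show hex.choose + 1 ≤ j by omega)
    linarith [h.2, hx.1]
  · have := ht.monotone (show j + 1 ≤ hex.choose by omega)
    linarith [h.1, hx.2]

/-- The kernel integral over `(0, x)` of the function with cell values `c`, for `x` in the `m`-th
cell. -/
noncomputable def cellInt (α : ℝ) (t : ℕ → ℝ) (c : ℕ → X) (m : ℕ) (x : ℝ) : X :=
  ∑ j ∈ Finset.range m, (prim α (x - t j) - prim α (x - t (j + 1))) • c j + prim α (x - t m) • c m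

/-- The kernel integral over `(0, t m)` of the function with cell values `c`. -/
noncomputable def nodeInt (α : ℝ) (t : ℕ → ℝ) (c : ℕ → X) (m : ℕ) : X :=
  ∑ j ∈ Finset.range m, (prim α (t m - t j) - prim α (t m - t (j + 1))) • c j

theorem cellInt_left (hα' : α < 1) (c : ℕ → X) (m : ℕ) :
    cellInt α t c m (t m) = nodeInt α t c m := by
  rw [cellInt, nodeInt, sub_self, prim_zero hα', zero_smul, add_zero]

/-- Together with `cellInt_left` this matches the formulas of adjacent cells at the node, so
integrals of the derivative become differences of nodal values. -/
theorem cellInt_right (hα' : α < 1) (c : ℕ → X) (m : ℕ) :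
    cellInt α t c m (t (m + 1)) = nodeInt α t c (m + 1) := by
  rw [cellInt, nodeInt, Finset.sum_range_succ, sub_self, prim_zero hα', sub_zero]

theorem intervalIntegrable_smul_const {f : ℝ → ℝ} {a b : ℝ}
    (hf : IntervalIntegrable f volume a b) (c : X) :
    IntervalIntegrable (fun x => f x • c) volume a b :=
  ⟨hf.1.smul_const c, hf.2.smul_const c⟩

theorem kernel_integral_const [CompleteSpace X] (hα' : α < 1) (x : ℝ) {a b : ℝ} (hab : a ≤ b) {f : ℝ → X} {c : X}
    (hf : ∀ s ∈ Ioo a b, f s = c) :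
    IntervalIntegrable (fun s => (x - s) ^ (-α) • f s) volume a b ∧
      ∫ s in a..b, (x - s) ^ (-α) • f s = (prim α (x - a) - prim α (x - b)) • c := by
  have h : ∀ s ∈ Ioo a b, (x - s) ^ (-α) • f s = (x - s) ^ (-α) • c := fun s hs => by rw [hf s hs]
  have hint : IntervalIntegrable (fun s => (x - s) ^ (-α) • c) volume a b :=
    intervalIntegrable_smul_const (intervalIntegrable_kernel hα' x a b) c
  refine ⟨intervalIntegrable_of_eq_Ioo hab h hint, ?_⟩
  rw [integral_eq_of_eq_Ioo hab h, intervalIntegral.integral_smul_const, integral_kernel hα']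

theorem fracInt_cell [CompleteSpace X] (hα' : α < 1) (ht0 : t 0 = 0) (ht : StrictMono t) {U : ℝ → X} {c : ℕ → X}
    (hU : HasCellValues t J U c) {m : ℕ} (hm : m < J) {x : ℝ} (hx : x ∈ Icc (t m) (t (m + 1))) :
    fracInt (1 - α) U x = (Real.Gamma (1 - α))⁻¹ • cellInt α t c m x := by
  have hcells : ∀ j < m, _ := fun j hj => kernel_integral_const hα' x
    (ht (Nat.lt_succ_self j)).le (hU j (hj.trans hm))
  have hlast := kernel_integral_const hα' x hx.1 (f := U) (c := c m)
    fun s hs => hU m hm s ⟨hs.1, hs.2.trans_le hx.2⟩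
  have hsum := intervalIntegral.sum_integral_adjacent_intervals (n := m) (a := t)
    fun j hj => (hcells j hj).1
  have hint := IntervalIntegrable.trans_iterate (n := m) (a := t) fun j hj => (hcells j hj).1
  rw [fracInt_eq, ← ht0, ← intervalIntegral.integral_add_adjacent_intervals hint hlast.1, ← hsum,
    hlast.2, cellInt, sub_self, prim_zero hα', sub_zero,
    Finset.sum_congr rfl fun j hj => (hcells j (Finset.mem_range.1 hj)).2]

/-- The derivative of `cellInt`. -/
noncomputable def cellDeriv (α : ℝ) (t : ℕ → ℝ) (c : ℕ → X) (m : ℕ) (x : ℝ) : X :=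
  ∑ j ∈ Finset.range m, ((x - t j) ^ (-α) - (x - t (j + 1)) ^ (-α)) • c j +
    (x - t m) ^ (-α) • c m

theorem hasDerivAt_cellInt (hα' : α < 1) (ht : StrictMono t) (c : ℕ → X) {m : ℕ} {x : ℝ}
    (hx : t m < x) : HasDerivAt (cellInt α t c m) (cellDeriv α t c m x) x := by
  have h1 : ∀ j ≤ m, HasDerivAt (fun x => prim α (x - t j)) ((x - t j) ^ (-α)) x := fun j hj => by
    have hj' := ht.monotone hj
    exact (hasDerivAt_prim hα' (by linarith : 0 < x - t j)).comp_sub_const x (t j)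
  refine HasDerivAt.add (HasDerivAt.fun_sum fun j hj => ?_) ((h1 m le_rfl).smul_const _)
  have hj' := Finset.mem_range.1 hj
  exact ((h1 j hj'.le).sub (h1 (j + 1) hj')).smul_const _

theorem continuous_cellInt (hα' : α < 1) (c : ℕ → X) (m : ℕ) : Continuous (cellInt α t c m) := by
  have h1 : ∀ j, Continuous fun x => prim α (x - t j) := fun j =>
    (continuous_prim hα').comp (by fun_prop)
  exact (continuous_finsetSum _ fun j _ => ((h1 j).sub (h1 (j + 1))).smul continuous_const).add
    ((h1 m).smul continuous_const)

theorem intervalIntegrable_cellDeriv (hα' : α < 1) (c : ℕ → X) (m : ℕ) (a b : ℝ) :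
    IntervalIntegrable (cellDeriv α t c m) volume a b := by
  have h1 : ∀ j, IntervalIntegrable (fun x => (x - t j) ^ (-α)) volume a b := fun j => by
    have h := (intervalIntegral.intervalIntegrable_rpow' (a := a - t j) (b := b - t j)
      (r := -α) (by linarith)).comp_sub_right (t j)
    simpa using h
  have h2 := IntervalIntegrable.sum (μ := volume) (a := a) (b := b) (Finset.range m)
    (f := fun j x => ((x - t j) ^ (-α) - (x - t (j + 1)) ^ (-α)) • c j)
    fun j _ => intervalIntegrable_smul_const ((h1 j).sub (h1 (j + 1))) _
  have h3 := h2.add (intervalIntegrable_smul_const (h1 m) (c m))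
  refine h3.congr fun x _ => ?_
  simp [cellDeriv, Finset.sum_apply]

/-- The derivative may be singular at the left node, but it is integrable and `cellInt` is
continuous there, which suffices for the fundamental theorem. -/
theorem integral_cellDeriv [CompleteSpace X] (hα' : α < 1) (ht : StrictMono t) (c : ℕ → X)
    (m : ℕ) :
    ∫ x in t m..t (m + 1), cellDeriv α t c m x = nodeInt α t c (m + 1) - nodeInt α t c m := by
  rw [intervalIntegral.integral_eq_sub_of_hasDerivAt_of_le (ht (Nat.lt_succ_self m)).le
    (continuous_cellInt hα' c m).continuousOn (fun x hx => hasDerivAt_cellInt hα' ht c hx.1)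
    (intervalIntegrable_cellDeriv hα' c m _ _), cellInt_right hα', cellInt_left hα']

theorem fracDeriv_cell [CompleteSpace X] (hα' : α < 1) (ht0 : t 0 = 0) (ht : StrictMono t) {U : ℝ → X} {c : ℕ → X}
    (hU : HasCellValues t J U c) {m : ℕ} (hm : m < J) {x : ℝ} (hx : x ∈ Ioo (t m) (t (m + 1))) :
    fracDeriv α U x = (Real.Gamma (1 - α))⁻¹ • cellDeriv α t c m x := by
  have h := (hasDerivAt_cellInt hα' ht c hx.1).const_smul (Real.Gamma (1 - α))⁻¹
  refine (h.congr_of_eventuallyEq ?_).deriv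
  filter_upwards [Ioo_mem_nhds hx.1 hx.2] with y hy
  exact fracInt_cell hα' ht0 ht hU hm ⟨hy.1.le, hy.2.le⟩

theorem inner_fracDeriv_cell [CompleteSpace X] (hα' : α < 1) (ht0 : t 0 = 0) (ht : StrictMono t)
    {U V : ℝ → X} {c v : ℕ → X} (hU : HasCellValues t J U c) (hV : HasCellValues t J V v) {m : ℕ}
    (hm : m < J) :
    IntervalIntegrable (fun x => (inner ℝ (fracDeriv α U x) (V x) : ℝ)) volume (t m) (t (m + 1)) ∧
      ∫ x in t m..t (m + 1), (inner ℝ (fracDeriv α U x) (V x) : ℝ) =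
        (Real.Gamma (1 - α))⁻¹ * inner ℝ (nodeInt α t c (m + 1) - nodeInt α t c m) (v m) := by
  have hle : t m ≤ t (m + 1) := (ht (Nat.lt_succ_self m)).le
  have hint := intervalIntegrable_cellDeriv (t := t) hα' c m (t m) (t (m + 1))
  have h : ∀ x ∈ Ioo (t m) (t (m + 1)), (inner ℝ (fracDeriv α U x) (V x) : ℝ) =
      (Real.Gamma (1 - α))⁻¹ * innerSL ℝ (v m) (cellDeriv α t c m x) := fun x hx => by
    rw [fracDeriv_cell hα' ht0 ht hU hm hx, hV m hm x hx, real_inner_smul_left,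
      innerSL_apply_apply, real_inner_comm]
  have hint' : IntervalIntegrable (fun x => (Real.Gamma (1 - α))⁻¹ *
      innerSL ℝ (v m) (cellDeriv α t c m x)) volume (t m) (t (m + 1)) := by
    refine IntervalIntegrable.const_mul ?_ _
    rw [intervalIntegrable_iff] at hint ⊢
    exact (innerSL ℝ (v m)).integrable_comp hint
  refine ⟨intervalIntegrable_of_eq_Ioo hle h hint', ?_⟩
  rw [integral_eq_of_eq_Ioo hle h, intervalIntegral.integral_const_mul,
    (innerSL ℝ (v m)).intervalIntegral_comp_comm hint, integral_cellDeriv hα' ht,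
    innerSL_apply_apply, real_inner_comm]

theorem integral_inner_fracDeriv [CompleteSpace X] (hα' : α < 1) (ht0 : t 0 = 0)
    (ht : StrictMono t) {U V : ℝ → X} {c v : ℕ → X} (hU : HasCellValues t J U c)
    (hV : HasCellValues t J V v) :
    ∫ x in (0 : ℝ)..t J, (inner ℝ (fracDeriv α U x) (V x) : ℝ) = ∑ m ∈ Finset.range J,
      (Real.Gamma (1 - α))⁻¹ * inner ℝ (nodeInt α t c (m + 1) - nodeInt α t c m) (v m) := by
  have h := fun m (hm : m < J) => inner_fracDeriv_cell hα' ht0 ht hU hV hm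
  rw [← ht0, ← intervalIntegral.sum_integral_adjacent_intervals fun m hm => (h m hm).1]
  exact Finset.sum_congr rfl fun m hm => (h m (Finset.mem_range.1 hm)).2

variable {A : X →ₗ.[ℝ] X}

theorem integral_dg_form [CompleteSpace X] (hα' : α < 1) (ht0 : t 0 = 0) (ht : StrictMono t)
    (S : SpectralDecomposition A) {U V : ℝ → X} {c v : ℕ → X} (hU : HasCellValues t J U c)
    (hV : HasCellValues t J V v) :
    ∫ x in (0 : ℝ)..t J, (inner ℝ (fracDeriv α U x) (V x) + S.energy (U x) (V x)) =
      ∑ m ∈ Finset.range J,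
        ((Real.Gamma (1 - α))⁻¹ * inner ℝ (nodeInt α t c (m + 1) - nodeInt α t c m) (v m) +
          (t (m + 1) - t m) * S.energy (c m) (v m)) := by
  have h := fun m (hm : m < J) => inner_fracDeriv_cell hα' ht0 ht hU hV hm
  have he : ∀ m < J, ∀ x ∈ Ioo (t m) (t (m + 1)), S.energy (U x) (V x) = S.energy (c m) (v m) :=
    fun m hm x hx => by rw [hU m hm x hx, hV m hm x hx]
  have hle : ∀ m, t m ≤ t (m + 1) := fun m => (ht (Nat.lt_succ_self m)).le
  have hei : ∀ m < J, IntervalIntegrable (fun x => S.energy (U x) (V x)) volume (t m) (t (m + 1)) :=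
    fun m hm => intervalIntegrable_of_eq_Ioo (hle m) (he m hm) intervalIntegrable_const
  rw [← ht0, ← intervalIntegral.sum_integral_adjacent_intervals
    fun m hm => (h m hm).1.add (hei m hm)]
  refine Finset.sum_congr rfl fun m hm => ?_
  have hm' := Finset.mem_range.1 hm
  rw [intervalIntegral.integral_add (h m hm').1 (hei m hm'), (h m hm').2,
    integral_eq_of_eq_Ioo (hle m) (he m hm'), intervalIntegral.integral_const, smul_eq_mul]

theorem nodeInt_const (hα' : α < 1) (ht0 : t 0 = 0) (c : X) (m : ℕ) :
    nodeInt α t (fun _ => c) m = prim α (t m) • c := by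
  rw [nodeInt, ← Finset.sum_smul]
  congr 1
  have h : ∀ j, prim α (t m - t j) - prim α (t m - t (j + 1)) =
      -prim α (t m - t (j + 1)) - -prim α (t m - t j) := fun j => by ring
  simp only [h]
  rw [Finset.sum_range_sub fun j => -prim α (t m - t j), sub_self, prim_zero hα', ht0, sub_zero]
  ring

theorem inner_nodeInt (c : ℕ → X) (y : X) (m : ℕ) : inner ℝ (nodeInt α t c m) y =
    ∑ j ∈ Finset.range m, (prim α (t m - t j) - prim α (t m - t (j + 1))) * inner ℝ (c j) y := by
  rw [nodeInt, sum_inner]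
  simp only [real_inner_smul_left]

theorem sum_dgMatrix_mul (μ : ℝ) (V : ℕ → ℝ) (m : ℕ) :
    ∑ j ∈ Finset.range (m + 1), dgMatrix α μ t m j * V j =
      ∑ j ∈ Finset.range (m + 1),
          (prim α (t (m + 1) - t j) - prim α (t (m + 1) - t (j + 1))) * V j +
        μ * ∑ j ∈ Finset.range (m + 1), (t (j + 1) - t j) * V j := by
  rw [Finset.mul_sum, ← Finset.sum_add_distrib]
  exact Finset.sum_congr rfl fun j _ => by rw [dgMatrix]; ring

theorem SpectralDecomposition.inner_basis (S : SpectralDecomposition A) (n k : ℕ) :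
    (inner ℝ (S.φ n) (S.φ k) : ℝ) = if n = k then 1 else 0 :=
  orthonormal_iff_ite.1 S.φ.orthonormal n k

theorem SpectralDecomposition.energy_basis (S : SpectralDecomposition A) (x : X) (n : ℕ) :
    S.energy x (S.φ n) = S.lam n * inner ℝ x (S.φ n) := by
  rw [energy, tsum_eq_single n]
  · rw [S.inner_basis, if_pos rfl, mul_one]
  · intro k hk
    rw [S.inner_basis, if_neg hk.symm, mul_zero]

theorem SpectralDecomposition.energy_zero (S : SpectralDecomposition A) (x : X) :
    S.energy x 0 = 0 := by
  simp [energy]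

theorem SpectralDecomposition.basis_mem_domPow (S : SpectralDecomposition A) (s : ℝ) (n : ℕ) :
    S.φ n ∈ S.domPow s := by
  refine summable_of_ne_finset_zero (s := {n}) fun k hk => ?_
  rw [S.inner_basis, if_neg fun h => hk (by simp [h])]
  simp

theorem SpectralDecomposition.zero_mem_domPow (S : SpectralDecomposition A) (s : ℝ) :
    (0 : X) ∈ S.domPow s := by
  simp [domPow]

end Scheme

/-! ### The graded grid -/

section Grid

variable {σ T : ℝ} {J : ℕ}

theorem grid_zero (hσ : 1 ≤ σ) : grid σ T J 0 = 0 := by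
  rw [grid, Nat.cast_zero, zero_div, Real.zero_rpow (by linarith), zero_mul]

theorem grid_self (hJ : 0 < J) : grid σ T J J = T := by
  rw [grid, div_self (Nat.cast_ne_zero.2 hJ.ne'), Real.one_rpow, one_mul]

theorem grid_strictMono (hσ : 1 ≤ σ) (hT : 0 < T) (hJ : 0 < J) : StrictMono (grid σ T J) := by
  intro i j hij
  have hJ' : (0 : ℝ) < J := Nat.cast_pos.2 hJ
  refine mul_lt_mul_of_pos_right (Real.rpow_lt_rpow (by positivity) ?_ (by linarith)) hT
  exact div_lt_div_of_pos_right (Nat.cast_lt.2 hij) hJ'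

/-- Midpoint convexity of `x ^ σ` at three consecutive points. -/
theorem grid_step_monotone (hσ : 1 ≤ σ) (hT : 0 < T) (J : ℕ) :
    Monotone fun j => grid σ T J (j + 1) - grid σ T J j := by
  refine monotone_nat_of_le_succ fun j => ?_
  have h := (convexOn_rpow hσ).2 (show (j : ℝ) / J ∈ Ici 0 from mem_Ici.2 (by positivity))
    (show ((j + 2 : ℕ) : ℝ) / J ∈ Ici 0 from mem_Ici.2 (by positivity))
    (show (0 : ℝ) ≤ 1 / 2 by norm_num) (show (0 : ℝ) ≤ 1 / 2 by norm_num) (by norm_num)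
  simp only [smul_eq_mul] at h
  rw [show 1 / 2 * ((j : ℝ) / J) + 1 / 2 * (((j + 2 : ℕ) : ℝ) / J) = ((j + 1 : ℕ) : ℝ) / J by
    push_cast; ring] at h
  simp only [grid]
  rw [show j + 1 + 1 = j + 2 from rfl]
  nlinarith

/-- The relative step is `(1 + 1 / i) ^ σ - 1`; convexity bounds it by the chord of `x ^ σ` over
`[1, 2]`. -/
theorem grid_step_le (hσ : 1 ≤ σ) (hT : 0 < T) (J : ℕ) {i : ℕ} (hi : 0 < i) :
    grid σ T J (i + 1) - grid σ T J i ≤ 2 ^ σ * (i : ℝ)⁻¹ * grid σ T J i := by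
  have hi' : (1 : ℝ) ≤ i := Nat.one_le_cast.2 hi
  have hx : (i : ℝ)⁻¹ ≤ 1 := inv_le_one_of_one_le₀ hi'
  have hx0 : 0 ≤ (i : ℝ)⁻¹ := by positivity
  have h := (convexOn_rpow hσ).2 (show (1 : ℝ) ∈ Ici 0 from mem_Ici.2 zero_le_one)
    (show (2 : ℝ) ∈ Ici 0 from mem_Ici.2 zero_le_two)
    (show 0 ≤ 1 - (i : ℝ)⁻¹ by linarith) hx0 (by ring)
  simp only [smul_eq_mul, Real.one_rpow, mul_one] at h
  rw [show 1 - (i : ℝ)⁻¹ + (i : ℝ)⁻¹ * 2 = 1 + (i : ℝ)⁻¹ by ring] at h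
  have h1 : grid σ T J (i + 1) = (1 + (i : ℝ)⁻¹) ^ σ * grid σ T J i := by
    rw [grid, grid, ← mul_assoc, ← Real.mul_rpow (by positivity) (by positivity)]
    congr 2
    push_cast
    field_simp
  have h2 : 0 ≤ grid σ T J i := mul_nonneg (Real.rpow_nonneg (by positivity) _) hT.le
  rw [h1]
  nlinarith

/-- The minimum in the convergence rate arises here: for `p ≥ 1` the power of `i / J ≤ 1` is reduced
to the first, and for `p ≤ 1` the factor `1 / i` absorbs `i ^ p`. -/
theorem inv_mul_div_rpow_le {i : ℕ} (hi : 0 < i) (hiJ : i ≤ J) (p : ℝ) :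
    (i : ℝ)⁻¹ * ((i : ℝ) / J) ^ p ≤ (J : ℝ) ^ (-(min p 1)) := by
  have hi' : (1 : ℝ) ≤ i := Nat.one_le_cast.2 hi
  have hi0 : (0 : ℝ) < i := by linarith
  have hiJ' : (i : ℝ) ≤ J := Nat.cast_le.2 hiJ
  have hJ0 : (0 : ℝ) < J := by linarith
  rcases le_total 1 p with h | h
  · rw [min_eq_right h, Real.rpow_neg_one]
    calc (i : ℝ)⁻¹ * ((i : ℝ) / J) ^ p ≤ (i : ℝ)⁻¹ * ((i : ℝ) / J) := by
          refine mul_le_mul_of_nonneg_left ?_ (by positivity)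
          have := Real.rpow_le_rpow_of_exponent_ge (show 0 < (i : ℝ) / J by positivity)
            ((div_le_one hJ0).2 hiJ') h
          rwa [Real.rpow_one] at this
      _ = (J : ℝ)⁻¹ := by field_simp
  · rw [min_eq_left h, Real.div_rpow hi0.le hJ0.le, Real.rpow_neg hJ0.le]
    have h1 : (i : ℝ) ^ p ≤ i := by
      have := Real.rpow_le_rpow_of_exponent_le hi' h
      rwa [Real.rpow_one] at this
    calc (i : ℝ)⁻¹ * ((i : ℝ) ^ p / (J : ℝ) ^ p) = (i : ℝ) ^ p / i * ((J : ℝ) ^ p)⁻¹ := by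
          field_simp
      _ ≤ 1 * ((J : ℝ) ^ p)⁻¹ :=
          mul_le_mul_of_nonneg_right ((div_le_one hi0).2 h1) (by positivity)
      _ = _ := one_mul _

theorem exists_cell {t : ℕ → ℝ} (ht0 : t 0 = 0) {x : ℝ} (hx0 : 0 < x) (hxJ : x < t J)
    (hx : x ∉ range t) : ∃ m < J, x ∈ Ioo (t m) (t (m + 1)) := by
  classical
  have hex : ∃ k, x < t k := ⟨J, hxJ⟩
  have h1 := Nat.find_spec hex
  have h2 : Nat.find hex ≠ 0 := fun h => by
    rw [h, ht0] at h1
    linarith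
  obtain ⟨m, hm⟩ := Nat.exists_eq_succ_of_ne_zero h2
  have h3 : ¬ x < t m := Nat.find_min hex (by omega)
  have h4 : Nat.find hex ≤ J := Nat.find_min' hex hxJ
  rw [hm] at h1
  refine ⟨m, by omega, lt_of_le_of_ne (not_lt.1 h3) fun h => hx ⟨m, h⟩, h1⟩

/-- The oscillation of the Mittag-Leffler function on the cells of the graded grid. -/
theorem relaxation_osc_le {α ν lam : ℝ} (hα : 0 < α) (hα' : α < 1) (hσ : 1 ≤ σ) (hν : 0 < ν)
    (hν' : ν ≤ 1) (hT : 0 < T) (hJ : 0 < J) (hlam : 0 < lam) {m : ℕ} (hm : m < J) {s r : ℝ}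
    (hs : s ∈ Icc (grid σ T J m) (grid σ T J (m + 1)))
    (hr : r ∈ Icc (grid σ T J m) (grid σ T J (m + 1))) :
    |relaxation α lam s - relaxation α lam r| ≤
      2 * 2 ^ σ * (Real.Gamma (1 - α) * T ^ α) ^ ν * (J : ℝ) ^ (-(min (σ * ν * α) 1)) *
        lam ^ ν := by
  have hG : 0 < Real.Gamma (1 - α) := Real.Gamma_pos_of_pos (by linarith)
  have hec := continuousOn_relaxation hα hlam.le
  have heq := fun x (hx : 0 ≤ x) => relaxation_relaxEq hα hα' hlam.le hx
  have hμ := (mul_pos hG hlam).le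
  have hshape := fun {a b : ℝ} (ha : 0 ≤ a) (hab : a ≤ b) => relaxation_shape hα hα' hμ hec heq ha hab
  have hmono := grid_strictMono hσ hT hJ
  have h0 : ∀ j, 0 ≤ grid σ T J j := fun j => (grid_zero (T := T) (J := J) hσ) ▸ hmono.monotone (Nat.zero_le j)
  have hJ' : (0 : ℝ) < J := Nat.cast_pos.2 hJ
  have hosc : |relaxation α lam s - relaxation α lam r| ≤
      relaxation α lam (grid σ T J m) - relaxation α lam (grid σ T J (m + 1)) := by
    have hs0 := (h0 m).trans hs.1
    have hr0 := (h0 m).trans hr.1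
    rw [abs_le]
    constructor <;> linarith [(hshape (h0 m) hs.1).2.1, (hshape (h0 m) hr.1).2.1,
      (hshape hs0 hs.2).2.1, (hshape hr0 hr.2).2.1]
  have hinit : ∀ j : ℕ, 0 < j → 1 - relaxation α lam (grid σ T J j) ≤
      2 * (Real.Gamma (1 - α) * T ^ α) ^ ν * lam ^ ν * ((j : ℝ) / J) ^ (σ * ν * α) := by
    intro j hj
    have hj0 : (0 : ℝ) < (j : ℝ) / J := div_pos (Nat.cast_pos.2 hj) hJ'
    have hgpos : 0 < grid σ T J j := mul_pos (Real.rpow_pos_of_pos hj0 _) hT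
    refine (relaxation_initial_rpow hα hα' hμ hec heq hgpos hν hν').trans (le_of_eq ?_)
    have hTα : 0 < T ^ α := Real.rpow_pos_of_pos hT _
    rw [grid, Real.mul_rpow (by positivity) hT.le, ← Real.rpow_mul hj0.le,
      show Real.Gamma (1 - α) * lam * (((j : ℝ) / J) ^ (σ * α) * T ^ α) =
        Real.Gamma (1 - α) * T ^ α * lam * ((j : ℝ) / J) ^ (σ * α) by ring,
      Real.mul_rpow (by positivity) (by positivity), Real.mul_rpow (by positivity) hlam.le,
      ← Real.rpow_mul hj0.le, show σ * α * ν = σ * ν * α by ring]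
    ring
  have hK : 0 ≤ 2 * (Real.Gamma (1 - α) * T ^ α) ^ ν * lam ^ ν := by positivity
  have h2σ : (1 : ℝ) ≤ 2 ^ σ := Real.one_le_rpow one_le_two (by linarith)
  refine hosc.trans ?_
  -- The secant inequality is void at time zero, so the first cell uses the initial bound at its
  -- right end; on later cells the secant inequality supplies the extra factor `1 / m`.
  rcases Nat.eq_zero_or_pos m with rfl | hmpos
  · rw [grid_zero hσ, relaxation_zero hα]
    have h1 := hinit 1 one_pos
    have h2 := inv_mul_div_rpow_le (J := J) one_pos hJ (σ * ν * α)
    rw [Nat.cast_one, inv_one, one_mul] at h2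
    rw [Nat.cast_one] at h1
    calc _ ≤ _ := h1
      _ ≤ 2 * (Real.Gamma (1 - α) * T ^ α) ^ ν * lam ^ ν * (J : ℝ) ^ (-(min (σ * ν * α) 1)) :=
        mul_le_mul_of_nonneg_left h2 hK
      _ ≤ 2 ^ σ * (2 * (Real.Gamma (1 - α) * T ^ α) ^ ν * lam ^ ν *
          (J : ℝ) ^ (-(min (σ * ν * α) 1))) :=
        le_mul_of_one_le_left (mul_nonneg hK (by positivity)) h2σ
      _ = _ := by ring
  · have hgpos : 0 < grid σ T J m := (h0 0).trans_lt (hmono hmpos)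
    have hmul := (hshape hgpos.le (hmono (Nat.lt_succ_self m)).le).2.2.2
    have h3 : 0 ≤ 1 - relaxation α lam (grid σ T J m) := by
      linarith [(hshape hgpos.le le_rfl).2.2.1]
    have h4 : relaxation α lam (grid σ T J m) - relaxation α lam (grid σ T J (m + 1)) ≤
        2 ^ σ * (m : ℝ)⁻¹ * (1 - relaxation α lam (grid σ T J m)) := by
      refine le_of_mul_le_mul_left (hmul.trans ?_) hgpos
      calc _ ≤ 2 ^ σ * (m : ℝ)⁻¹ * grid σ T J m * (1 - relaxation α lam (grid σ T J m)) :=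
            mul_le_mul_of_nonneg_right (grid_step_le hσ hT J hmpos) h3
        _ = _ := by ring
    calc _ ≤ _ := h4
      _ ≤ 2 ^ σ * (m : ℝ)⁻¹ * (2 * (Real.Gamma (1 - α) * T ^ α) ^ ν * lam ^ ν *
          ((m : ℝ) / J) ^ (σ * ν * α)) :=
        mul_le_mul_of_nonneg_left (hinit m hmpos) (by positivity)
      _ = 2 ^ σ * (2 * (Real.Gamma (1 - α) * T ^ α) ^ ν * lam ^ ν) *
          ((m : ℝ)⁻¹ * ((m : ℝ) / J) ^ (σ * ν * α)) := by ring
      _ ≤ 2 ^ σ * (2 * (Real.Gamma (1 - α) * T ^ α) ^ ν * lam ^ ν) *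
          (J : ℝ) ^ (-(min (σ * ν * α) 1)) :=
        mul_le_mul_of_nonneg_left (inv_mul_div_rpow_le hmpos hm.le _)
          (mul_nonneg (by positivity) hK)
      _ = _ := by ring

end Grid

/-! ### Existence of the discrete solution and the error estimate -/

section Discrete

variable {X : Type*} [NormedAddCommGroup X] [InnerProductSpace ℝ X] {A : X →ₗ.[ℝ] X}
  {α σ T : ℝ} {J : ℕ}

theorem SpectralDecomposition.exists_cellValues_of_mem_W (S : SpectralDecomposition A)
    {v : ℝ → X} (hv : v ∈ S.W σ T J) :
    ∃ c : ℕ → X, (∀ j < J, c j ∈ S.domPow (1 / 2)) ∧ HasCellValues (grid σ T J) J v c := by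
  classical
  choose! c hc hv' using fun (j : ℕ) (hj : j < J) => hv (j + 1) (by omega) hj
  exact ⟨c, hc, hv'⟩

theorem SpectralDecomposition.mem_W_of_cellValues (S : SpectralDecomposition A)
    {v : ℝ → X} {c : ℕ → X} (hc : ∀ j < J, c j ∈ S.domPow (1 / 2))
    (hv : HasCellValues (grid σ T J) J v c) : v ∈ S.W σ T J := by
  intro j hj hjJ
  obtain ⟨i, rfl⟩ : ∃ i, j = i + 1 := ⟨j - 1, by omega⟩
  exact ⟨c i, hc i hjJ, hv i hjJ⟩

theorem sum_dgMatrix_mul_inner {t : ℕ → ℝ} (c : ℕ → X) (y : X) (m : ℕ) (μ : ℝ) :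
    ∑ j ∈ Finset.range (m + 1), dgMatrix α μ t m j * inner ℝ (c j) y =
      inner ℝ (nodeInt α t c (m + 1)) y +
        μ * ∑ j ∈ Finset.range (m + 1), (t (j + 1) - t j) * inner ℝ (c j) y := by
  rw [sum_dgMatrix_mul, inner_nodeInt]

variable [CompleteSpace X]

/-- The coefficients of the cell values of a discrete solution solve the scalar scheme. -/
theorem SpectralDecomposition.IsDG.coeff_eq (hα' : α < 1) (hσ : 1 ≤ σ) (hT : 0 < T)
    (hJ : 0 < J) (S : SpectralDecomposition A) {u₀ : X} {U : ℝ → X}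
    (hU : S.IsDG α σ T J u₀ U) {c : ℕ → X} (hc : HasCellValues (grid σ T J) J U c) (n : ℕ) {m : ℕ}
    (hm : m < J) :
    ∑ j ∈ Finset.range (m + 1), dgMatrix α (Real.Gamma (1 - α) * S.lam n) (grid σ T J) m j *
      inner ℝ (c j) (S.φ n) = inner ℝ u₀ (S.φ n) * prim α (grid σ T J (m + 1)) := by
  have hG : 0 < Real.Gamma (1 - α) := Real.Gamma_pos_of_pos (by linarith)
  set t := grid σ T J
  have ht0 : t 0 = 0 := grid_zero hσ
  have ht : StrictMono t := grid_strictMono hσ hT hJ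
  have hcell : ∀ k < J, inner ℝ (nodeInt α t c (k + 1)) (S.φ n) -
      inner ℝ (nodeInt α t c k) (S.φ n) + Real.Gamma (1 - α) * S.lam n *
        ((t (k + 1) - t k) * inner ℝ (c k) (S.φ n)) =
      inner ℝ u₀ (S.φ n) * prim α (t (k + 1)) - inner ℝ u₀ (S.φ n) * prim α (t k) := by
    intro k hk
    have : Inhabited X := ⟨0⟩
    -- Testing with one eigenvector on one cell isolates a single scalar equation; summing over the
    -- cells then recovers the time-integrated system.
    obtain ⟨V, hV⟩ := exists_hasCellValues ht J fun j => if j = k then S.φ n else 0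
    have hVW : V ∈ S.W σ T J := S.mem_W_of_cellValues (fun j _ => by
      split_ifs
      · exact S.basis_mem_domPow _ n
      · exact S.zero_mem_domPow _) hV
    have h := hU.equation V hVW
    have hconst : HasCellValues t J (fun _ : ℝ => u₀) fun _ => u₀ := fun _ _ _ _ => rfl
    rw [← grid_self (σ := σ) (T := T) hJ] at h
    have hl := integral_dg_form hα' ht0 ht S hc hV
    have hr := integral_inner_fracDeriv hα' ht0 ht hconst hV
    rw [hl, hr, Finset.sum_eq_single k, Finset.sum_eq_single k] at h
    · simp only [if_true, nodeInt_const hα' ht0, S.energy_basis, inner_sub_left,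
        real_inner_smul_left] at h
      field_simp at h
      linarith
    · intro j _ hj
      simp [hj]
    · intro hk'
      exact absurd (Finset.mem_range.2 hk) hk'
    · intro j _ hj
      simp [hj, S.energy_zero]
    · intro hk'
      exact absurd (Finset.mem_range.2 hk) hk'
  have hsum := Finset.sum_congr rfl fun k (hk : k ∈ Finset.range (m + 1)) =>
    hcell k (by have := Finset.mem_range.1 hk; omega)
  rw [Finset.sum_add_distrib, Finset.sum_range_sub fun k => (inner ℝ (nodeInt α t c k) (S.φ n) : ℝ),
    Finset.sum_range_sub fun k => inner ℝ u₀ (S.φ n) * prim α (t k), ht0, prim_zero hα',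
    ← Finset.mul_sum] at hsum
  rw [sum_dgMatrix_mul_inner]
  simpa [nodeInt] using hsum

/-- Scalar discrete solutions are bounded by `1`, and by a multiple of `1 / μ` on each cell. -/
theorem exists_scalar_dg (hα : 0 < α) (hα' : α < 1) {μ : ℝ} (hμ : 0 ≤ μ) {t : ℕ → ℝ}
    (ht0 : t 0 = 0) (ht : StrictMono t) :
    ∃ V : ℕ → ℝ, (∀ m, ∑ j ∈ Finset.range (m + 1), dgMatrix α μ t m j * V j =
        prim α (t (m + 1))) ∧ (∀ m, 0 ≤ V m) ∧ (∀ m, V m ≤ 1) ∧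
      ∀ m, μ * V m ≤ prim α (t (m + 1)) / (t (m + 1) - t m) := by
  have hpos := dgMatrix_pos (μ := μ) hα' hμ ht
  have hdec := dgMatrix_decreasing hα hα' hμ ht
  have hnn : ∀ j, 0 ≤ t j := fun j => ht0 ▸ ht.monotone (Nat.zero_le j)
  obtain ⟨V, hV⟩ := exists_triangular_solution (dgMatrix α μ t)
    (fun m => (hpos m m le_rfl).ne') fun m => prim α (t (m + 1))
  have hV0 : ∀ m, 0 ≤ V m := fun m =>
    triangular_nonneg (M := m) (fun m => hpos m m le_rfl) hdec (prim_nonneg hα' (hnn _))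
      (fun i _ => prim_le_prim hα' (hnn _) (ht.monotone (Nat.le_succ _))) (fun i _ => hV i) m le_rfl
  refine ⟨V, hV, hV0, fun m => ?_, fun m => ?_⟩
  -- The complement `1 - V` solves the system with nondecreasing data `μ * t (m + 1)`.
  · have h := triangular_nonneg (V := fun j => 1 - V j) (F := fun m => μ * t (m + 1)) (M := m)
      (fun m => hpos m m le_rfl) hdec (mul_nonneg hμ (hnn _))
      (fun i _ => mul_le_mul_of_nonneg_left (ht.monotone (Nat.le_succ _)) hμ) (fun i _ => by
        simp only [mul_sub, Finset.sum_sub_distrib, mul_one]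
        rw [hV, sum_dgMatrix hα' ht0]
        ring) m le_rfl
    linarith
  · have hτ : ∀ j, 0 < t (j + 1) - t j := fun j => sub_pos.2 (ht (Nat.lt_succ_self j))
    rw [le_div_iff₀ (hτ m), ← hV m, Finset.sum_range_succ]
    have h1 : 0 ≤ ∑ j ∈ Finset.range m, dgMatrix α μ t m j * V j :=
      Finset.sum_nonneg fun j hj =>
        mul_nonneg (hpos m j (Finset.mem_range.1 hj).le).le (hV0 j)
    have h2 : μ * (t (m + 1) - t m) ≤ dgMatrix α μ t m m := by
      rw [dgMatrix, sub_self, prim_zero hα', sub_zero]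
      linarith [prim_pos hα' (hτ m)]
    nlinarith [mul_le_mul_of_nonneg_right h2 (hV0 m)]

/-- Existence for the discrete problem. -/
theorem exists_isDG (hα : 0 < α) (hα' : α < 1) (hσ : 1 ≤ σ) (hT : 0 < T) (hJ : 0 < J)
    (S : SpectralDecomposition A) (u₀ : X) : ∃ U, S.IsDG α σ T J u₀ U := by
  have hG : 0 < Real.Gamma (1 - α) := Real.Gamma_pos_of_pos (by linarith)
  have hu0 := (hasSum_coeff_sq S.φ u₀).summable
  obtain ⟨t, ht_def⟩ : ∃ t, t = grid σ T J := ⟨_, rfl⟩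
  have ht0 : t 0 = 0 := ht_def ▸ grid_zero hσ
  have ht : StrictMono t := ht_def ▸ grid_strictMono hσ hT hJ
  choose V hV hV0 hV1 hVb using fun n =>
    exists_scalar_dg hα hα' (Gamma_mul_lam_pos hα' S n).le ht0 ht
  let K : ℕ → ℝ := fun m => (Real.Gamma (1 - α))⁻¹ * (prim α (t (m + 1)) / (t (m + 1) - t m))
  have hK : ∀ n m, S.lam n * V n m ≤ K m := by
    intro n m
    have h := mul_le_mul_of_nonneg_left (hVb n m) (inv_pos.2 hG).le
    rwa [← mul_assoc, inv_mul_cancel_left₀ hG.ne'] at h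
  have hlV : ∀ n m, 0 ≤ S.lam n * V n m := fun n m => mul_nonneg (S.lam_pos n).le (hV0 n m)
  choose c hc using fun m => exists_coeff S.φ (f := fun n => V n m * inner ℝ u₀ (S.φ n)) (by
    refine hu0.of_nonneg_of_le (fun n => sq_nonneg _) fun n => ?_
    rw [mul_pow]
    exact mul_le_of_le_one_left (sq_nonneg _) (pow_le_one₀ (hV0 n m) (hV1 n m)))
  -- `w m` stands for `A (c m)`: the bound `K m` is uniform over the modes, so it is a genuine
  -- element of `X` and turns the energy pairing into an inner product.
  choose w hw using fun m => exists_coeff S.φ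
    (f := fun n => S.lam n * V n m * inner ℝ u₀ (S.φ n)) (by
      refine (hu0.mul_left (K m ^ 2)).of_nonneg_of_le (fun n => sq_nonneg _) fun n => ?_
      rw [mul_pow]
      exact mul_le_mul_of_nonneg_right (pow_le_pow_left₀ (hlV n m) (hK n m) 2) (sq_nonneg _))
  have hdom : ∀ m, c m ∈ S.domPow (1 / 2) := by
    intro m
    refine (hu0.mul_left (K m)).of_nonneg_of_le (fun n => ?_) fun n => ?_
    · exact mul_nonneg (Real.rpow_nonneg (S.lam_pos n).le _) (sq_nonneg _)
    · rw [hc, show 2 * (1 / 2 : ℝ) = 1 by norm_num, Real.rpow_one, mul_pow, ← mul_assoc]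
      refine mul_le_mul_of_nonneg_right ?_ (sq_nonneg _)
      rw [sq, ← mul_assoc]
      exact (mul_le_of_le_one_right (hlV n m) (hV1 n m)).trans (hK n m)
  have henergy : ∀ m v, S.energy (c m) v = inner ℝ (w m) v := by
    intro m v
    rw [← S.φ.tsum_inner_mul_inner (w m) v, SpectralDecomposition.energy]
    refine tsum_congr fun n => ?_
    rw [hc, hw, real_inner_comm v]
    ring
  -- This is the time-integrated scheme in `X`, verified mode by mode; differencing it gives the
  -- equation on each cell for arbitrary test values.
  have hnode : ∀ m, nodeInt α t c (m + 1) +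
      Real.Gamma (1 - α) • ∑ j ∈ Finset.range (m + 1), (t (j + 1) - t j) • w j =
        prim α (t (m + 1)) • u₀ := by
    intro m
    refine basis_ext S.φ fun n => ?_
    rw [inner_add_left, inner_nodeInt, real_inner_smul_left, sum_inner, real_inner_smul_left,
      ← hV n m, sum_dgMatrix_mul, add_mul, Finset.sum_mul, mul_assoc (_ * _), Finset.sum_mul,
      mul_assoc (Real.Gamma _), Finset.mul_sum (s := Finset.range (m + 1)) (a := S.lam n)]
    refine congrArg₂ (· + ·) (Finset.sum_congr rfl fun j _ => ?_)
      (congrArg _ (Finset.sum_congr rfl fun j _ => ?_))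
    · rw [hc]
      ring
    · rw [real_inner_smul_left, hw]
      ring
  have hstep : ∀ m, nodeInt α t c (m + 1) - nodeInt α t c m +
      Real.Gamma (1 - α) • (t (m + 1) - t m) • w m =
        (prim α (t (m + 1)) - prim α (t m)) • u₀ := by
    intro m
    have h1 := hnode m
    cases m with
    | zero =>
      rw [ht0, prim_zero hα', sub_zero (prim α _), ← h1]
      simp [nodeInt, ht0]
    | succ m =>
      rw [sub_smul (prim α _), ← h1, ← hnode m, Finset.sum_range_succ _ (m + 1), smul_add]
      abel
  have : Inhabited X := ⟨0⟩
  obtain ⟨U, hU⟩ := exists_hasCellValues ht J c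
  refine ⟨U, S.mem_W_of_cellValues (fun j _ => hdom j) (ht_def ▸ hU), fun v hv => ?_⟩
  obtain ⟨b, -, hb⟩ := S.exists_cellValues_of_mem_W hv
  rw [← ht_def] at hb
  have hconst : HasCellValues t J (fun _ : ℝ => u₀) fun _ => u₀ := fun _ _ _ _ => rfl
  have hTt : T = t J := by rw [ht_def, grid_self hJ]
  rw [hTt, integral_dg_form hα' ht0 ht S hU hb, integral_inner_fracDeriv hα' ht0 ht hconst hb]
  refine Finset.sum_congr rfl fun m _ => ?_
  rw [henergy, nodeInt_const hα' ht0, nodeInt_const hα' ht0, ← sub_smul, ← hstep m,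
    inner_add_left, real_inner_smul_left, real_inner_smul_left]
  field_simp

theorem RelaxEq.const_mul {μ c x : ℝ} {v : ℝ → ℝ} (h : RelaxEq α μ c v x) (k : ℝ) :
    RelaxEq α μ (k * c) (fun s => k * v s) x := by
  rw [RelaxEq] at h ⊢
  simp only [mul_left_comm _ k, intervalIntegral.integral_const_mul]
  linear_combination k * h

/-- The error estimate. -/
theorem dg_error (hα : 0 < α) (hα' : α < 1) (hσ : 1 ≤ σ) {ν : ℝ} (hν : 0 < ν) (hν' : ν ≤ 1)
    (hT : 0 < T) (hJ : 0 < J) (hA : IsAdmissible A) (S : SpectralDecomposition A) {u₀ : X}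
    (hu₀ : u₀ ∈ S.domPow ν) {u : ℝ → X} (hu : IsSolution A α T u₀ u) {U : ℝ → X}
    (hU : S.IsDG α σ T J u₀ U) {x : ℝ} (hx : x ∈ Ioo 0 T) (hxg : x ∉ range (grid σ T J)) :
    ‖u x - U x‖ ≤ 5 * (2 * 2 ^ σ * (Real.Gamma (1 - α) * T ^ α) ^ ν) *
      (J : ℝ) ^ (-(min (σ * ν * α) 1)) * S.normPow ν u₀ := by
  have hG : 0 < Real.Gamma (1 - α) := Real.Gamma_pos_of_pos (by linarith)
  have ht0 : grid σ T J 0 = 0 := grid_zero hσ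
  have ht := grid_strictMono hσ hT hJ
  obtain ⟨c, -, hc⟩ := S.exists_cellValues_of_mem_W hU.mem
  obtain ⟨m, hm, hxm⟩ := exists_cell ht0 hx.1 (hx.2.trans_eq (grid_self hJ).symm) hxg
  have hsq : ∀ n, (S.lam n ^ ν * inner ℝ u₀ (S.φ n)) ^ 2 =
      S.lam n ^ (2 * ν) * inner ℝ u₀ (S.φ n) ^ 2 := fun n => by
    rw [mul_pow, ← Real.rpow_mul_natCast (S.lam_pos n).le, mul_comm ν, Nat.cast_ofNat]
  have hsum : Summable fun n => (S.lam n ^ ν * inner ℝ u₀ (S.φ n)) ^ 2 := by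
    simp only [hsq]
    exact hu₀
  have hnorm : S.normPow ν u₀ = Real.sqrt (∑' n, (S.lam n ^ ν * inner ℝ u₀ (S.φ n)) ^ 2) := by
    simp only [hsq]
    rfl
  rw [hnorm]
  refine norm_le_of_coeff_le S.φ (by positivity) (fun n => ?_) hsum
  have hlam := S.lam_pos n
  obtain ⟨k, hk⟩ : ∃ k : ℝ, k = inner ℝ u₀ (S.φ n) := ⟨_, rfl⟩
  obtain ⟨ε, hε⟩ : ∃ ε, ε = 2 * 2 ^ σ * (Real.Gamma (1 - α) * T ^ α) ^ ν *
      (J : ℝ) ^ (-(min (σ * ν * α) 1)) * S.lam n ^ ν := ⟨_, rfl⟩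
  have hnn : ∀ j, 0 ≤ grid σ T J j := fun j => ht0 ▸ ht.monotone (Nat.zero_le j)
  -- The oscillation bound carries `λₙ ^ ν`, which is attached to the coefficient of `u₀` so that
  -- summing squares produces `normPow ν`.
  have h := dg_scalar_error (t := grid σ T J) (c := k * 1) (ε := |k| * ε) (M := m)
    (v := fun s => k * relaxation α (S.lam n) s) (V := fun j => inner ℝ (c j) (S.φ n)) (s := x)
    hα hα' (Gamma_mul_lam_pos hα' S n).le ht0 ht (grid_step_monotone hσ hT J)
    (continuousOn_const.mul ((continuousOn_relaxation hα hlam.le).mono Icc_subset_Ici_self))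
    (fun j _ => (relaxation_relaxEq hα hα' hlam.le (hnn _)).const_mul k)
    (fun j hj => by rw [hU.coeff_eq hα' hσ hT hJ S hc n (by omega), hk, mul_one])
    (fun j hj s hs r hr => by
      rw [← mul_sub, abs_mul, hε]
      exact mul_le_mul_of_nonneg_left
        (relaxation_osc_le hα hα' hσ hν hν' hT hJ hlam (by omega) hs hr) (abs_nonneg _))
    ⟨hxm.1.le, hxm.2.le⟩
  rw [inner_sub_left, hc m hm x hxm, hu.coeff_eq hα hα' hA S n ⟨hx.1.le, hx.2⟩, ← hk, abs_sub_comm,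
    mul_comm (relaxation _ _ _)]
  refine h.trans (le_of_eq ?_)
  rw [abs_mul, abs_of_pos (Real.rpow_pos_of_pos hlam ν), hε]
  ring

end Discrete

end FracDG

/-! ### The main theorem -/

theorem theorem3p1 (α σ ν T : ℝ) (hα : 0 < α) (hα' : α < 1) (hσ : 1 ≤ σ)
    (hν : 0 < ν) (hν' : ν ≤ 1) (hT : 0 < T) :
    ∃ C : ℝ, 0 < C ∧
      ∀ (X : Type*) [NormedAddCommGroup X] [InnerProductSpace ℝ X] [CompleteSpace X]
        [TopologicalSpace.SeparableSpace X] (hX : ¬ FiniteDimensional ℝ X)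
        (A : X →ₗ.[ℝ] X) (hA : FracDG.IsAdmissible A),
        ∀ u₀ ∈ (FracDG.spectralDecomposition hX hA).domPow ν,
          (∃ u : ℝ → X, FracDG.IsSolution A α T u₀ u) ∧
          ∀ J : ℕ, 0 < J →
            (∃ U : ℝ → X, (FracDG.spectralDecomposition hX hA).IsDG α σ T J u₀ U) ∧
            ∀ u : ℝ → X, FracDG.IsSolution A α T u₀ u →
            ∀ U : ℝ → X, (FracDG.spectralDecomposition hX hA).IsDG α σ T J u₀ U →
              eLpNorm (u - U) ∞ (volume.restrict (Ioo 0 T)) ≤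
                ENNReal.ofReal (C * (J : ℝ) ^ (-(min (σ * ν * α) 1)) *
                  (FracDG.spectralDecomposition hX hA).normPow ν u₀) := by
  have hG : 0 < Real.Gamma (1 - α) := Real.Gamma_pos_of_pos (by linarith)
  refine ⟨5 * (2 * 2 ^ σ * (Real.Gamma (1 - α) * T ^ α) ^ ν), by positivity, ?_⟩
  intro X _ _ _ _ hX A hA u₀ hu₀
  refine ⟨FracDG.exists_isSolution hα hα' hA (FracDG.spectralDecomposition hX hA) T u₀,
    fun J hJ => ⟨FracDG.exists_isDG hα hα' hσ hT hJ _ u₀, fun u hu U hU => ?_⟩⟩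
  rw [eLpNorm_exponent_top]
  refine eLpNormEssSup_le_of_ae_bound ((ae_restrict_iff' measurableSet_Ioo).2 ?_)
  -- The scheme leaves values at grid points free; they form a countable, hence null, set.
  have hcount : ∀ᵐ x : ℝ, x ∉ range (FracDG.grid σ T J) := (countable_range _).ae_notMem volume
  filter_upwards [hcount] with x hxg hx
  exact FracDG.dg_error hα hα' hσ hν hν' hT hJ hA _ hu₀ hu hU hx hxg
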